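/- Let $N\in\mathbf N$ and $\mathbf T^N=\mathbf R^N/\mathbf Z^N$; functions on $\mathbf T^N$ are identified with $\mathbf Z^N$-periodic functions on $\mathbf R^N$. Let $\sigma:\mathbf T^N\to(0,\infty)$ be continuous, and let $m:[0,\infty)\to(0,1)$ be Lipschitz continuous with Lipschitz constant $L$, strictly increasing, with $m(r)\to1$ as $r\to\infty$. Put $H(x,p)=\sigma(x)m(|p|)$ for $(x,p)\in\mathbf T^N\times\mathbf R^N$, $\overline\sigma=\sup_{\mathbf T^N}\sigma$, $\underline\sigma=\inf_{\mathbf T^N}\sigma$ and $m_0=m(0)$. For a Hamiltonian $G:\mathbf T^N\times\mathbf R^N\to\mathbf R$ and $P\in\mathbf R^N$, a solution of the cell problem is a pair $(u,a)\in\mathrm{Lip}(\mathbf T^N)\times\mathbf R$ such that $u$ is a viscosity solution of $G(x,Du(x)+P)=a$ in $\mathbf T^N$, that is, for every $\phi\in C^1(\mathbf T^N)$ one has $G(\hat x,D\phi(\hat x)+P)\le a$ at each point $\hat x$ where $u-\phi$ attains its maximum over $\mathbf T^N$, and $G(\hat x,D\phi(\hat x)+P)\ge a$ at each point $\hat x$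 where $u-\phi$ attains its minimum over $\mathbf T^N$. If there is exactly one $a$ for which a solution $(u,a)$ exists, it is called the critical value at $P$; if this is so for every $P$, the function $\bar G$ that sends $P$ to the critical value at $P$ is called the effective Hamiltonian of $G$. An approximating sequence of $H$ is a sequence of continuous functions $H_n:\mathbf T^N\times\mathbf R^N\to\mathbf R$ such that each $H_n$ is coercive, i.e. $\inf\{H_n(x,p)\mid x\in\mathbf T^N,\ |p|\ge r\}\to+\infty$ as $r\to\infty$, and such that $$\liminf_{n\to\infty}\inf_{\mathbf T^N\times\overline{B(0,R)}}(H-H_n)\ge0\ \text{ for all }R>0,\qquad \limsup_{n\to\infty}\sup_{\mathbf T^N\times\mathbf R^N}(H-H_n)\le0 .$$ A generalized effective Hamiltonian of $H$ is a function $\bar H_\infty:\mathbf R^N\to\mathbf R$ such that for every approximating sequence $(H_n)$ of $H$, with effective Hamiltonians $\bar H_n$ (which exist because the $H_n$ are continuous and coercive), $$\liminf_{n\to\infty}\inf_{\overline{B(0,R)}}(\bar H_\infty-\bar H_n)\ge0\ \text{ for all }R>0,\qquad \limsup_{n\to\infty}\sup_{\mathbf R^N}(\bar H_\infty-\bar H_n)\le0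 .$$ **Proposition.** There is exactly one generalized effective Hamiltonian $\bar H_\infty$ of $H$, and it has the following properties: 1. $|\bar H_\infty(P)-\bar H_\infty(Q)|\le\overline\sigma L|P-Q|$ for all $P,Q\in\mathbf R^N$; 2. $\bar H_\infty(kP)\ge\bar H_\infty(P)$ for all $P\in\mathbf R^N$ and all real $k\ge1$; 3. $\bar H_\infty(P)=\bar H_\infty(-P)$ for all $P\in\mathbf R^N$; 4. $\max\{\underline\sigma m(|P|),\overline\sigma m_0\}\le\bar H_\infty(P)\le\overline\sigma m(|P|)<\overline\sigma$ for all $P\in\mathbf R^N$. -/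

import Mathlib

open scoped NNReal

namespace CellProblem

/-- Euclidean space `ℝ^N`. -/
abbrev Space (N : ℕ) : Type := EuclideanSpace ℝ (Fin N)

/-- `ℤ^N`-periodicity. Functions on the torus `𝕋^N = ℝ^N / ℤ^N` are represented by the
`ℤ^N`-periodic functions on `ℝ^N`. -/
def IsPeriodic {N : ℕ} {α : Type} (u : Space N → α) : Prop :=
  ∀ (x : Space N) (z : Fin N → ℤ), u (x + WithLp.toLp 2 (fun i => (z i : ℝ))) = u x

/-- `D⁺u(x)`: the gradients at `x` of the `C¹` functions `φ` on the torus for which `u - φ` attains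
its maximum over the torus at `x`. -/
def superdifferential {N : ℕ} (u : Space N → ℝ) (x : Space N) : Set (Space N) :=
  {p | ∃ φ : Space N → ℝ, IsPeriodic φ ∧ ContDiff ℝ 1 φ ∧
    (∀ y, u y - φ y ≤ u x - φ x) ∧ gradient φ x = p}

/-- `D⁻u(x)`: the gradients at `x` of the `C¹` functions `φ` on the torus for which `u - φ` attains
its minimum over the torus at `x`. -/
def subdifferential {N : ℕ} (u : Space N → ℝ) (x : Space N) : Set (Space N) :=
  {p | ∃ φ : Space N → ℝ, IsPeriodic φ ∧ ContDiff ℝ 1 φ ∧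
    (∀ y, u x - φ x ≤ u y - φ y) ∧ gradient φ x = p}

/-- `u ∈ C(𝕋^N)` is a viscosity subsolution of `F(x, Du(x)) = 0` in `𝕋^N`. -/
def IsSubsolution {N : ℕ} (F : Space N → Space N → ℝ) (u : Space N → ℝ) : Prop :=
  IsPeriodic u ∧ Continuous u ∧ ∀ x, ∀ p ∈ superdifferential u x, F x p ≤ 0

/-- `u ∈ C(𝕋^N)` is a viscosity supersolution of `F(x, Du(x)) = 0` in `𝕋^N`. -/
def IsSupersolution {N : ℕ} (F : Space N → Space N → ℝ) (u : Space N → ℝ) : Prop :=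
  IsPeriodic u ∧ Continuous u ∧ ∀ x, ∀ p ∈ subdifferential u x, 0 ≤ F x p

/-- `u` is a viscosity solution of `F(x, Du(x)) = 0` in `𝕋^N`. -/
def IsViscositySolution {N : ℕ} (F : Space N → Space N → ℝ) (u : Space N → ℝ) : Prop :=
  IsSubsolution F u ∧ IsSupersolution F u

/-- `(u, a) ∈ Lip(𝕋^N) × ℝ` is a solution of the cell problem
`H(x, Du(x) + P) = a` in `𝕋^N`. -/
def IsCellSolution {N : ℕ} (H : Space N → Space N → ℝ) (P : Space N)
    (u : Space N → ℝ) (a : ℝ) : Prop :=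
  (∃ K : ℝ≥0, LipschitzWith K u) ∧ IsViscositySolution (fun x p => H x (p + P) - a) u

/-- `a` is the critical value of the cell problem for `H` at `P`: it is the one and only constant
for which the cell problem has a solution. -/
def IsCriticalValue {N : ℕ} (H : Space N → Space N → ℝ) (P : Space N) (a : ℝ) : Prop :=
  (∃ u, IsCellSolution H P u a) ∧ ∀ b, (∃ u, IsCellSolution H P u b) → b = a

/-- The cell problem for `H` is fully solvable and `Hbar` is the effective Hamiltonian of `H`. -/
def IsEffectiveHamiltonian {N : ℕ} (H : Space N → Space N → ℝ) (Hbar : Space N → ℝ) : Prop :=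
  ∀ P, IsCriticalValue H P (Hbar P)

/-- `H(x, p) → +∞` as `|p| → ∞`, uniformly in `x`. -/
def IsCoercive {N : ℕ} (H : Space N → Space N → ℝ) : Prop :=
  ∀ A : ℝ, ∃ r : ℝ, ∀ x p : Space N, r ≤ ‖p‖ → A ≤ H x p

/-- `liminf_{n → ∞} inf_{|p| ≤ R} (f - f_n) ≥ 0` for all `R > 0` and
`limsup_{n → ∞} sup (f - f_n) ≤ 0`, for functions `f, f_n` of `(i, p) ∈ ι × ℝ^N`; the infimum and
the supremum are also over `i ∈ ι`. -/
structure ConvergesFromAbove {N : ℕ} {ι : Type} (f : ι → Space N → ℝ)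
    (fn : ℕ → ι → Space N → ℝ) : Prop where
  liminf_nonneg : ∀ R > 0, ∀ ε > 0, ∃ n₀ : ℕ, ∀ n ≥ n₀, ∀ (i : ι) (p : Space N),
    ‖p‖ ≤ R → -ε ≤ f i p - fn n i p
  limsup_nonpos : ∀ ε > 0, ∃ n₀ : ℕ, ∀ n ≥ n₀, ∀ (i : ι) (p : Space N),
    f i p - fn n i p ≤ ε

/-- `(H_n)` is a sequence of continuous coercive Hamiltonians on `𝕋^N × ℝ^N` which approximates
`H`. -/
structure IsApproximation {N : ℕ} (H : Space N → Space N → ℝ)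
    (Hn : ℕ → Space N → Space N → ℝ) : Prop where
  periodic : ∀ n, IsPeriodic (Hn n)
  continuous : ∀ n, Continuous (fun q : Space N × Space N => Hn n q.1 q.2)
  coercive : ∀ n, IsCoercive (Hn n)
  converges : ConvergesFromAbove H Hn

/-- `Hinf` is a generalized effective Hamiltonian of `H`: for every approximating sequence `(H_n)`
of `H`, the effective Hamiltonians `Hbar_n` of `H_n` satisfy
`liminf_{n → ∞} inf_{|P| ≤ R} (Hinf - Hbar_n) ≥ 0` for all `R > 0` and
`limsup_{n → ∞} sup_{ℝ^N} (Hinf - Hbar_n) ≤ 0`. -/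
def IsGeneralizedEffectiveHamiltonian {N : ℕ} (H : Space N → Space N → ℝ)
    (Hinf : Space N → ℝ) : Prop :=
  ∀ Hn : ℕ → Space N → Space N → ℝ, IsApproximation H Hn →
    ∀ Hbar : ℕ → Space N → ℝ, (∀ n, IsEffectiveHamiltonian (Hn n) (Hbar n)) →
      ConvergesFromAbove (fun _ : Unit => Hinf) (fun n _ => Hbar n)

end CellProblem

/-! The candidate is `infLevel H P`, the infimum of the levels `a` at which `H(x, Du + P) ≤ a` has a
Lipschitz subsolution. It requires no solvability of the cell problem for the bounded, hence
non-coercive, `H`.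

Both halves of the convergence transfer subsolutions (`isGeneralizedEffectiveHamiltonian_infLevel`).
For large `n`, `H ≤ H_n + ε` everywhere, so a critical solution for `H_n` at `P` is a subsolution
for `H` at level `Hbar_n(P) + ε`, for all `P` at once. Conversely, a nearly optimal Lipschitz
subsolution for `H` has bounded gradients, and on bounded sets `H_n ≤ H + ε`; so it is a subsolution
for `H_n`, and comparison of constants (`le_of_isSubsolution_of_isSupersolution`, by doubling
variables) bounds `Hbar_n(P)` from above.

Two generalized effective Hamiltonians are squeezed against the same `Hbar_n`, provided some
approximating sequence has effective Hamiltonians. These come from Perron's method for the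
discounted equation (`exists_discounted_solution`) and the vanishing discount limit
(`exists_isCellSolution`).

Of the four properties only symmetry is delicate: `-u` must be a subsolution at `-P`, so a gradient
bound has to pass from superdifferentials to subdifferentials. The sublevel sets of `H` in `p` are
balls, and `norm_add_le_of_mem_subdifferential` makes the passage by comparing `u` with a cone. -/

namespace CellProblem

open Filter Topology

variable {N : ℕ}

/-! ### Periodic functions and a periodic penalization -/

/-- The point of the lattice `ℤ^N ⊂ ℝ^N` with coordinates `z`. -/
noncomputable def latticePoint (z : Fin N → ℤ) : Space N := WithLp.toLp 2 (fun i => (z i : ℝ))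

@[simp] lemma latticePoint_apply (z : Fin N → ℤ) (i : Fin N) : latticePoint z i = z i := rfl

lemma latticePoint_neg (z : Fin N → ℤ) : latticePoint (-z) = -latticePoint z := by
  ext i; simp

lemma IsPeriodic.add_latticePoint {α : Type} {u : Space N → α} (hu : IsPeriodic u)
    (x : Space N) (z : Fin N → ℤ) : u (x + latticePoint z) = u x := hu x z

/-- A periodic smooth penalization, comparable with the square of the distance to `ℤ^N`. -/
noncomputable def periodicSq (x : Space N) : ℝ := ∑ i, (1 - Real.cos (2 * Real.pi * x i))

lemma periodicSq_nonneg (x : Space N) : 0 ≤ periodicSq x :=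
  Finset.sum_nonneg fun i _ => by linarith [Real.cos_le_one (2 * Real.pi * x i)]

@[simp] lemma periodicSq_zero : periodicSq (0 : Space N) = 0 := by simp [periodicSq]

lemma periodicSq_neg (x : Space N) : periodicSq (-x) = periodicSq x := by
  simp [periodicSq]

lemma periodicSq_le (x : Space N) : periodicSq x ≤ 2 * N := by
  have : periodicSq x ≤ ∑ _i : Fin N, (2 : ℝ) :=
    Finset.sum_le_sum fun i _ => by linarith [Real.neg_one_le_cos (2 * Real.pi * x i)]
  simpa [mul_comm] using this

lemma isPeriodic_periodicSq : IsPeriodic (periodicSq (N := N)) := by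
  intro x z
  refine Finset.sum_congr rfl fun i _ => ?_
  have h : 2 * Real.pi * (x + WithLp.toLp 2 (fun i => (z i : ℝ)) : Space N) i
      = 2 * Real.pi * x i + z i * (2 * Real.pi) := by
    simp only [PiLp.add_apply]; ring
  rw [h, Real.cos_add_int_mul_two_pi]

lemma contDiff_coord (i : Fin N) : ContDiff ℝ 1 (fun x : Space N => x i) :=
  (EuclideanSpace.proj (𝕜 := ℝ) i).contDiff

lemma contDiff_periodicSq : ContDiff ℝ 1 (periodicSq (N := N)) := by
  unfold periodicSq
  refine ContDiff.sum fun i _ => contDiff_const.sub (Real.contDiff_cos.comp ?_)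
  exact contDiff_const.mul (contDiff_coord i)

lemma eight_mul_sq_le {t : ℝ} (ht : |t| ≤ 1 / 2) : 8 * t ^ 2 ≤ 1 - Real.cos (2 * Real.pi * t) := by
  have hpi := Real.pi_pos
  have h : |2 * Real.pi * t| ≤ Real.pi := by
    rw [abs_mul, abs_of_pos (by positivity)]; nlinarith
  have := Real.cos_le_one_sub_mul_cos_sq h
  have h2 : 2 / Real.pi ^ 2 * (2 * Real.pi * t) ^ 2 = 8 * t ^ 2 := by field_simp; ring
  linarith

lemma eight_mul_norm_sq_le {x : Space N} (hx : ∀ i, |x i| ≤ 1 / 2) :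
    8 * ‖x‖ ^ 2 ≤ periodicSq x := by
  rw [EuclideanSpace.real_norm_sq_eq, Finset.mul_sum]
  exact Finset.sum_le_sum fun i _ => eight_mul_sq_le (hx i)

lemma exists_latticePoint_abs_le (x : Space N) :
    ∃ z : Fin N → ℤ, ∀ i, |(x + latticePoint z) i| ≤ 1 / 2 := by
  refine ⟨fun i => -round (x i), fun i => ?_⟩
  have := abs_sub_round (x i)
  simpa [sub_eq_add_neg] using this

/-- Rounding the coordinates puts a representative in the cube where `1 - cos (2πt) ≥ 8t²`. This is
how a bound on the penalization becomes closeness modulo the lattice. -/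
lemma exists_eight_mul_norm_sq_le (x : Space N) :
    ∃ z : Fin N → ℤ, 8 * ‖x + latticePoint z‖ ^ 2 ≤ periodicSq x := by
  obtain ⟨z, hz⟩ := exists_latticePoint_abs_le x
  exact ⟨z, (eight_mul_norm_sq_le hz).trans_eq (isPeriodic_periodicSq.add_latticePoint x z)⟩

lemma exists_norm_le (x : Space N) :
    ∃ z : Fin N → ℤ, ‖x + latticePoint z‖ ≤ √N := by
  obtain ⟨z, hz⟩ := exists_eight_mul_norm_sq_le x
  refine ⟨z, Real.le_sqrt_of_sq_le ?_⟩
  have := periodicSq_le x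
  nlinarith [sq_nonneg ‖x + latticePoint z‖]

/-- A closed ball that meets every class modulo `ℤ^N`. -/
abbrev cell (N : ℕ) : Set (Space N) := Metric.closedBall 0 √N

lemma exists_mem_cell (x : Space N) : ∃ z : Fin N → ℤ, x + latticePoint z ∈ cell N := by
  obtain ⟨z, hz⟩ := exists_norm_le x
  exact ⟨z, by simpa using hz⟩

lemma isCompact_cell : IsCompact (cell N) := isCompact_closedBall _ _

lemma cell_nonempty : (cell N).Nonempty := ⟨0, by simp⟩

lemma IsPeriodic.exists_forall_le {f : Space N → ℝ} (hf : IsPeriodic f) (hc : Continuous f) :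
    ∃ x, ∀ y, f y ≤ f x := by
  obtain ⟨x, -, hx⟩ := isCompact_cell.exists_isMaxOn cell_nonempty hc.continuousOn
  refine ⟨x, fun y => ?_⟩
  obtain ⟨z, hz⟩ := exists_mem_cell y
  rw [← hf.add_latticePoint y z]
  exact hx hz

lemma IsPeriodic.neg {f : Space N → ℝ} (hf : IsPeriodic f) : IsPeriodic (fun x => -f x) :=
  fun x z => by simp only [hf x z]

lemma IsPeriodic.add {f g : Space N → ℝ} (hf : IsPeriodic f) (hg : IsPeriodic g) :
    IsPeriodic (fun x => f x + g x) :=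
  fun x z => by simp only [hf x z, hg x z]

lemma IsPeriodic.sub {f g : Space N → ℝ} (hf : IsPeriodic f) (hg : IsPeriodic g) :
    IsPeriodic (fun x => f x - g x) :=
  fun x z => by simp only [hf x z, hg x z]

lemma IsPeriodic.const_mul {f : Space N → ℝ} (hf : IsPeriodic f) (c : ℝ) :
    IsPeriodic (fun x => c * f x) :=
  fun x z => by simp only [hf x z]

lemma isPeriodic_const (c : ℝ) : IsPeriodic (fun _ : Space N => c) := fun _ _ => rfl

lemma IsPeriodic.comp_sub {f : Space N → ℝ} (hf : IsPeriodic f) (y : Space N) :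
    IsPeriodic (fun x => f (x - y)) := fun x z => by
  simp only [add_sub_right_comm]
  exact hf _ _

lemma IsPeriodic.exists_forall_ge {f : Space N → ℝ} (hf : IsPeriodic f) (hc : Continuous f) :
    ∃ x, ∀ y, f x ≤ f y := by
  obtain ⟨x, hx⟩ := hf.neg.exists_forall_le hc.neg
  exact ⟨x, fun y => neg_le_neg_iff.1 (hx y)⟩

lemma contDiff_periodicSq_sub (y : Space N) : ContDiff ℝ 1 (fun x : Space N => periodicSq (x - y)) :=
  contDiff_periodicSq.comp (contDiff_id.sub contDiff_const)

/-! ### Gradients and semidifferentials -/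

lemma _root_.ContDiff.hasGradientAt {φ : Space N → ℝ} (h : ContDiff ℝ 1 φ) (x : Space N) :
    HasGradientAt φ (gradient φ x) x :=
  (h.differentiable one_ne_zero x).hasGradientAt

lemma _root_.ContDiff.continuous_gradient {φ : Space N → ℝ} (h : ContDiff ℝ 1 φ) :
    Continuous (gradient φ) :=
  (InnerProductSpace.toDual ℝ (Space N)).symm.continuous.comp (h.continuous_fderiv one_ne_zero)

lemma _root_.HasGradientAt.comp_sub_const {φ : Space N → ℝ} {g x y : Space N}
    (h : HasGradientAt φ g (x - y)) : HasGradientAt (fun x => φ (x - y)) g x := by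
  rw [hasGradientAt_iff_hasFDerivAt] at h ⊢
  exact (hasFDerivAt_comp_sub y).2 h

lemma _root_.HasGradientAt.fun_add {φ χ : Space N → ℝ} {g h x : Space N}
    (hφ : HasGradientAt φ g x) (hχ : HasGradientAt χ h x) :
    HasGradientAt (fun x => φ x + χ x) (g + h) x := by
  rw [hasGradientAt_iff_hasFDerivAt] at *
  simpa using hφ.fun_add hχ

lemma _root_.HasGradientAt.fun_neg {φ : Space N → ℝ} {g x : Space N}
    (hφ : HasGradientAt φ g x) : HasGradientAt (fun x => -φ x) (-g) x := by
  rw [hasGradientAt_iff_hasFDerivAt] at *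
  simpa using hφ.fun_neg

lemma _root_.HasGradientAt.const_mul_right {φ : Space N → ℝ} {g x : Space N}
    (hφ : HasGradientAt φ g x) (c : ℝ) : HasGradientAt (fun x => c * φ x) (c • g) x := by
  rw [hasGradientAt_iff_hasFDerivAt] at *
  simpa using hφ.const_mul c

/-- Directional derivatives. -/
lemma _root_.HasGradientAt.hasDerivAt_line {φ : Space N → ℝ} {g x : Space N}
    (hφ : HasGradientAt φ g x) (v : Space N) :
    HasDerivAt (fun t : ℝ => φ (x + t • v)) (inner ℝ g v) 0 := by
  have hl : HasDerivAt (fun t : ℝ => x + t • v) v 0 := by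
    simpa using ((hasDerivAt_id (0 : ℝ)).smul_const v).const_add x
  have h2 : HasFDerivAt φ (InnerProductSpace.toDual ℝ (Space N) g) (x + (0 : ℝ) • v) := by
    simpa using hφ.hasFDerivAt
  have h3 := h2.comp_hasDerivAt 0 hl
  rwa [InnerProductSpace.toDual_apply_apply] at h3

lemma nonneg_of_hasDerivAt_of_forall_le {g : ℝ → ℝ} {g' : ℝ} (h : HasDerivAt g g' 0)
    {ρ : ℝ} (hρ : 0 < ρ) (hg : ∀ t, 0 < t → t < ρ → g 0 ≤ g t) : 0 ≤ g' := by
  have h1 := (hasDerivAt_iff_tendsto_slope.1 h).mono_left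
    (nhdsWithin_mono (0 : ℝ) (fun t (ht : t ∈ Set.Ioi (0 : ℝ)) => (ne_of_gt ht : t ≠ 0)))
  refine ge_of_tendsto h1 ?_
  filter_upwards [Ioo_mem_nhdsGT hρ] with t ht
  rw [slope_def_field]
  exact div_nonneg (sub_nonneg.2 (hg t ht.1 ht.2)) (by simpa using ht.1.le)

lemma superdifferential_of_hasGradientAt {u φ : Space N → ℝ} {x p : Space N} (hφ : IsPeriodic φ)
    (hd : ContDiff ℝ 1 φ) (hx : ∀ y, u y - φ y ≤ u x - φ x) (hp : HasGradientAt φ p x) :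
    p ∈ superdifferential u x :=
  ⟨φ, hφ, hd, hx, hp.gradient⟩

lemma mem_subdifferential_iff {u : Space N → ℝ} {x p : Space N} :
    p ∈ subdifferential u x ↔ -p ∈ superdifferential (fun y => -u y) x := by
  constructor
  · rintro ⟨φ, hφ, hd, hx, rfl⟩
    exact superdifferential_of_hasGradientAt hφ.neg hd.neg (fun y => by linarith [hx y])
      (hd.hasGradientAt x).fun_neg
  · rintro ⟨φ, hφ, hd, hx, h⟩
    refine ⟨fun y => -φ y, hφ.neg, hd.neg, fun y => by linarith [hx y], ?_⟩
    have := (hd.hasGradientAt x).fun_neg.gradient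
    rw [this, h, neg_neg]

lemma mem_superdifferential_iff {u : Space N → ℝ} {x p : Space N} :
    p ∈ superdifferential u x ↔ -p ∈ subdifferential (fun y => -u y) x := by
  simp [mem_subdifferential_iff]

lemma superdifferential_add_latticePoint {u : Space N → ℝ} (hu : IsPeriodic u) {x p : Space N}
    (hp : p ∈ superdifferential u x) (z : Fin N → ℤ) :
    p ∈ superdifferential u (x + latticePoint z) := by
  obtain ⟨φ, hφ, hd, hx, rfl⟩ := hp
  refine superdifferential_of_hasGradientAt hφ hd (fun y => ?_) ?_
  · rw [hu.add_latticePoint, hφ.add_latticePoint]; exact hx y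
  · have h : HasGradientAt φ (gradient φ x) (x + latticePoint z - latticePoint z) := by
      simpa using hd.hasGradientAt x
    have h2 := h.comp_sub_const
    convert h2 using 2 with y
    have := hφ.add_latticePoint y (-z)
    rw [latticePoint_neg, ← sub_eq_add_neg] at this
    exact this.symm

/-- Along `-p` the test function falls at rate `‖p‖²`, while it dominates the increments of `u`,
which falls at rate at most `K‖p‖`. -/
lemma norm_le_of_mem_superdifferential {u : Space N → ℝ} {K : ℝ≥0} (hu : LipschitzWith K u)
    {x p : Space N} (hp : p ∈ superdifferential u x) : ‖p‖ ≤ K := by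
  obtain ⟨φ, hφ, hd, hx, rfl⟩ := hp
  set p := gradient φ x
  have h := (hd.hasGradientAt x).hasDerivAt_line (-p)
  have h2 : HasDerivAt (fun t : ℝ => φ (x + t • (-p)) + t * (K * ‖p‖))
      (inner ℝ p (-p) + 1 * (K * ‖p‖)) 0 :=
    h.fun_add ((hasDerivAt_id (0 : ℝ)).mul_const (K * ‖p‖))
  have h3 := nonneg_of_hasDerivAt_of_forall_le h2 one_pos (fun t ht _ => by
    have h4 := hx (x + t • (-p))
    have h5 := hu.dist_le_mul x (x + t • (-p))
    rw [Real.dist_eq, dist_self_add_right, norm_smul, norm_neg, Real.norm_of_nonneg ht.le] at h5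
    have h6 := le_abs_self (u x - u (x + t • (-p)))
    simp only [zero_smul, add_zero, zero_mul]
    nlinarith)
  rw [inner_neg_right, real_inner_self_eq_norm_sq] at h3
  by_contra hcon
  push Not at hcon
  have : 0 ≤ (K : ℝ) := K.2
  nlinarith

/-- If a function touches `u` from below at `x`, every `C¹` test function from above has its gradient. -/
lemma eq_gradient_of_mem_superdifferential {b u χ : Space N → ℝ} {x g : Space N}
    (hb : HasGradientAt b g x) (hχ : ContDiff ℝ 1 χ) (hbu : ∀ y, b y ≤ u y) (hx : b x = u x)
    (hmax : ∀ y, u y - χ y ≤ u x - χ x) : gradient χ x = g := by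
  have hd := (hχ.hasGradientAt x).fun_add hb.fun_neg
  rw [hasGradientAt_iff_hasFDerivAt] at hd
  have hmin : IsLocalMin (fun y => χ y + -b y) x := Filter.Eventually.of_forall fun y => by
    show χ x + -b x ≤ χ y + -b y
    linarith [hbu y, hmax y]
  have := hmin.hasFDerivAt_eq_zero hd
  rw [EmbeddingLike.map_eq_zero_iff] at this
  exact eq_neg_of_add_eq_zero_left this |>.trans (neg_neg g)

lemma superdifferential_const {c : ℝ} {x p : Space N}
    (hp : p ∈ superdifferential (fun _ => c) x) : p = 0 := by
  have := norm_le_of_mem_superdifferential (LipschitzWith.const c) hp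
  simpa using this

lemma zero_mem_superdifferential {u : Space N → ℝ} {x : Space N} (hx : ∀ y, u y ≤ u x) :
    0 ∈ superdifferential u x := by
  refine superdifferential_of_hasGradientAt (isPeriodic_const 0) contDiff_const
    (fun y => by simpa using hx y) ?_
  rw [hasGradientAt_iff_hasFDerivAt]
  simpa using hasFDerivAt_const (0 : ℝ) x

lemma continuous_periodicSq : Continuous (periodicSq (N := N)) := contDiff_periodicSq.continuous

/-! ### Comparison of constants -/

/-- Doubling of variables. -/
lemma exists_mem_superdifferential_inter_subdifferential {u v : Space N → ℝ} (hu : IsPeriodic u)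
    (huc : Continuous u) (hv : IsPeriodic v) {K : ℝ≥0} (hvK : LipschitzWith K v) {ε : ℝ}
    (hε : 0 < ε) :
    ∃ x ∈ cell N, ∃ y, ‖x - y‖ ≤ ε ∧ ∃ p, p ∈ superdifferential u x ∧ p ∈ subdifferential v y := by
  -- Comparing the maximum with the diagonal gives `8c‖x - y‖ ≤ K` when `x ≠ y`; since `cε = K + 1`,
  -- this forces `‖x - y‖ ≤ ε`.
  set c : ℝ := (K + 1) / ε with hc
  have hK : (0 : ℝ) ≤ K := K.2
  have hc0 : 0 < c := by positivity
  set Φ : Space N → Space N → ℝ := fun x y => u x - v y - c * periodicSq (x - y) with hΦ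
  have hΦc : Continuous fun q : Space N × Space N => Φ q.1 q.2 :=
    ((huc.comp continuous_fst).sub (hvK.continuous.comp continuous_snd)).sub
      (continuous_const.mul (continuous_periodicSq.comp (continuous_fst.sub continuous_snd)))
  obtain ⟨⟨x, y₀⟩, ⟨hx, -⟩, hmax⟩ := (isCompact_cell.prod isCompact_cell).exists_isMaxOn
    (cell_nonempty.prod cell_nonempty) hΦc.continuousOn
  have hΦl : ∀ x' y' z, Φ (x' + latticePoint z) y' = Φ x' y' := fun x' y' z => by
    simp only [hΦ, hu.add_latticePoint, add_sub_right_comm,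
      isPeriodic_periodicSq.add_latticePoint]
  have hΦr : ∀ x' y' z, Φ x' (y' + latticePoint z) = Φ x' y' := fun x' y' z => by
    simp only [hΦ, hv.add_latticePoint]
    rw [← sub_sub, sub_eq_add_neg (x' - y'), ← latticePoint_neg,
      isPeriodic_periodicSq.add_latticePoint]
  have hglob : ∀ x' y', Φ x' y' ≤ Φ x y₀ := fun x' y' => by
    obtain ⟨z, hz⟩ := exists_mem_cell x'
    obtain ⟨z', hz'⟩ := exists_mem_cell y'
    rw [← hΦl x' y' z, ← hΦr _ y' z']
    exact hmax (Set.mk_mem_prod hz hz')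
  obtain ⟨z, hz⟩ := exists_eight_mul_norm_sq_le (x - y₀)
  -- The function `Φ` is periodic in each variable, so `y₀` may be moved until `x - y` itself obeys
  -- the quadratic bound.
  set y := y₀ + latticePoint (-z) with hy
  have hxy : x - y₀ + latticePoint z = x - y := by rw [hy, latticePoint_neg]; abel
  have hψ : periodicSq (x - y₀) = periodicSq (x - y) := by
    rw [← hxy, isPeriodic_periodicSq.add_latticePoint]
  rw [hxy, hψ] at hz
  have hglob' : ∀ x' y', Φ x' y' ≤ Φ x y := fun x' y' => by
    rw [hy, hΦr]; exact hglob x' y'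
  refine ⟨x, hx, y, ?_, c • gradient periodicSq (x - y), ?_, ?_⟩
  · have h1 := hglob' x x
    simp only [hΦ, sub_self, periodicSq_zero, mul_zero] at h1
    have h2 := hvK.dist_le_mul x y
    rw [Real.dist_eq, dist_eq_norm] at h2
    have h3 := le_abs_self (v x - v y)
    have h4 : c * (8 * ‖x - y‖ ^ 2) ≤ K * ‖x - y‖ :=
      (mul_le_mul_of_nonneg_left hz hc0.le).trans (by linarith)
    by_contra hcon
    push Not at hcon
    have h5 : c * ε = K + 1 := by rw [hc]; field_simp
    have h6 : 0 < ‖x - y‖ := hε.trans hcon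
    have h7 : c * (8 * ‖x - y‖) ≤ K := by
      refine le_of_mul_le_mul_right ?_ h6
      calc c * (8 * ‖x - y‖) * ‖x - y‖ = c * (8 * ‖x - y‖ ^ 2) := by ring
        _ ≤ _ := h4
    have h8 : c * ε ≤ c * ‖x - y‖ := mul_le_mul_of_nonneg_left hcon.le hc0.le
    linarith
  · refine superdifferential_of_hasGradientAt ((isPeriodic_periodicSq.comp_sub y).const_mul c)
      (contDiff_const.mul (contDiff_periodicSq_sub y)) (fun x' => ?_)
      ((contDiff_periodicSq.hasGradientAt (x - y)).comp_sub_const.const_mul_right c)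
    have := hglob' x' y
    simp only [hΦ] at this
    linarith
  · rw [mem_subdifferential_iff]
    have hd := contDiff_periodicSq.hasGradientAt (x - y)
    have hd' : HasGradientAt periodicSq (-gradient periodicSq (x - y)) (y - x) := by
      have h1 : HasFDerivAt (fun w : Space N => -w) (-ContinuousLinearMap.id ℝ (Space N)) (y - x) :=
        (hasFDerivAt_id _).neg
      rw [hasGradientAt_iff_hasFDerivAt] at hd ⊢
      rw [← neg_sub y x] at hd
      have h2 : HasFDerivAt (fun w : Space N => periodicSq (-w)) _ (y - x) := hd.comp (y - x) h1
      simp only [periodicSq_neg] at h2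
      refine h2.congr_fderiv ?_
      ext w
      simp only [neg_sub, map_neg, ContinuousLinearMap.comp_apply, neg_apply,
        ContinuousLinearMap.id_apply]
    refine superdifferential_of_hasGradientAt ((isPeriodic_periodicSq.comp_sub x).const_mul c)
      (contDiff_const.mul (contDiff_periodicSq_sub x)) (fun y' => ?_)
      (by simpa using hd'.comp_sub_const.const_mul_right c)
    have := hglob' x y'
    simp only [hΦ] at this
    rw [← periodicSq_neg (y' - x), ← periodicSq_neg (y - x), neg_sub, neg_sub]
    linarith

/-- Comparison of the constants of a subsolution and a supersolution. -/
lemma le_of_isSubsolution_of_isSupersolution {F : Space N → Space N → ℝ}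
    (hF : Continuous fun q : Space N × Space N => F q.1 q.2) {u v : Space N → ℝ} {a b : ℝ}
    {K K' : ℝ≥0} (huK : LipschitzWith K u) (hvK : LipschitzWith K' v)
    (hu : IsSubsolution (fun x p => F x p - a) u)
    (hv : IsSupersolution (fun x p => F x p - b) v) : b ≤ a := by
  have h : ∀ k : ℕ, ∃ x ∈ cell N, ∃ y, ‖x - y‖ ≤ 1 / ((k : ℝ) + 1) ∧
      ∃ p, p ∈ superdifferential u x ∧ p ∈ subdifferential v y := fun k =>
    exists_mem_superdifferential_inter_subdifferential hu.1 huK.continuous hv.1 hvK (by positivity)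
  -- The shared gradients are bounded by the Lipschitz constant of `u`, so a subsequence converges
  -- and `b ≤ F x₀ p₀ ≤ a`; coercivity plays no role.
  choose x hx y hxy p hpu hpv using h
  have hmem : ∀ k, (x k, p k) ∈ cell N ×ˢ Metric.closedBall (0 : Space N) K := fun k =>
    ⟨hx k, by simpa using norm_le_of_mem_superdifferential huK (hpu k)⟩
  obtain ⟨⟨x₀, p₀⟩, -, s, hs, hlim⟩ :=
    (isCompact_cell.prod (isCompact_closedBall (0 : Space N) K)).tendsto_subseq hmem
  have hd : Tendsto (fun k => x k - y k) atTop (𝓝 0) :=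
    squeeze_zero_norm hxy tendsto_one_div_add_atTop_nhds_zero_nat
  have hxl : Tendsto (fun k => x (s k)) atTop (𝓝 x₀) :=
    (continuous_fst.tendsto _).comp hlim
  have hpl : Tendsto (fun k => p (s k)) atTop (𝓝 p₀) :=
    (continuous_snd.tendsto _).comp hlim
  have hyl : Tendsto (fun k => y (s k)) atTop (𝓝 x₀) := by
    simpa using hxl.sub (hd.comp hs.tendsto_atTop)
  have h1 := (hF.tendsto (x₀, p₀)).comp (hxl.prodMk_nhds hpl)
  have h2 := (hF.tendsto (x₀, p₀)).comp (hyl.prodMk_nhds hpl)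
  refine (ge_of_tendsto' h2 fun k => ?_).trans (le_of_tendsto' h1 fun k => ?_)
  · exact sub_nonneg.1 (hv.2.2 _ _ (hpv (s k)))
  · exact sub_nonpos.1 (hu.2.2 _ _ (hpu (s k)))

/-! ### Stability and density of superdifferentials -/

lemma gradient_periodicSq_zero : gradient (periodicSq (N := N)) 0 = 0 := by
  have h : IsLocalMin (periodicSq (N := N)) 0 :=
    Eventually.of_forall fun y => by simpa using periodicSq_nonneg y
  have h2 := contDiff_periodicSq.hasGradientAt (0 : Space N)
  rw [hasGradientAt_iff_hasFDerivAt] at h2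
  simpa only [EmbeddingLike.map_eq_zero_iff] using h.hasFDerivAt_eq_zero h2

/-- Stability of superdifferentials under one-sided uniform convergence. -/
lemma exists_tendsto_superdifferential {ι : Type} {l : Filter ι} {u : Space N → ℝ}
    (huc : Continuous u) {v : ι → Space N → ℝ} (hv : ∀ k, IsPeriodic (v k))
    (hvc : ∀ k, Continuous (v k)) {x p : Space N} (hp : p ∈ superdifferential u x)
    (hle : ∀ ε > 0, ∀ᶠ k in l, ∀ y, v k y ≤ u y + ε)
    (hx : Tendsto (fun k => v k x) l (𝓝 (u x))) :
    ∃ (y q : ι → Space N), (∀ k, q k ∈ superdifferential (v k) (y k)) ∧ Tendsto y l (𝓝 x) ∧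
      Tendsto q l (𝓝 p) ∧ Tendsto (fun k => v k (y k)) l (𝓝 (u x)) := by
  obtain ⟨φ, hφ, hφd, hmax, rfl⟩ := hp
  -- The penalization makes the maximum at `x` strict modulo the lattice without changing the
  -- gradient there.
  have hχp : IsPeriodic fun w => φ w + periodicSq (w - x) :=
    hφ.add (isPeriodic_periodicSq.comp_sub x)
  have hχd : ContDiff ℝ 1 fun w => φ w + periodicSq (w - x) :=
    hφd.add (contDiff_periodicSq_sub x)
  have h : ∀ k, ∃ y, (∀ w, v k w - (φ w + periodicSq (w - x))
      ≤ v k y - (φ y + periodicSq (y - x))) ∧ 8 * ‖y - x‖ ^ 2 ≤ periodicSq (y - x) := fun k => by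
    obtain ⟨y, hy⟩ := ((hv k).sub hχp).exists_forall_le ((hvc k).sub hχd.continuous)
    obtain ⟨z, hz⟩ := exists_eight_mul_norm_sq_le (y - x)
    refine ⟨y + latticePoint z, fun w => ?_, ?_⟩
    · rw [((hv k).sub hχp).add_latticePoint y z]; exact hy w
    · rw [add_sub_right_comm, isPeriodic_periodicSq.add_latticePoint]; exact hz
  choose y hy hyx using h
  have hbound : ∀ k, v k x - φ x + 8 * ‖y k - x‖ ^ 2 ≤ v k (y k) - φ (y k) := fun k => by
    have h1 := hy k x
    simp only [sub_self, periodicSq_zero] at h1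
    linarith [hyx k]
  have hyl : Tendsto y l (𝓝 x) := by
    rw [Metric.tendsto_nhds]
    intro ε hε
    have hε2 : 0 < 4 * ε ^ 2 := by positivity
    filter_upwards [hle _ hε2, hx.eventually (lt_mem_nhds (sub_lt_self (u x) hε2))] with k h1 h2
    rw [dist_eq_norm]
    have := h1 (y k)
    have := hbound k
    have := hmax (y k)
    refine lt_of_pow_lt_pow_left₀ 2 hε.le ?_
    linarith
  refine ⟨y, fun k => gradient φ (y k) + gradient periodicSq (y k - x), fun k => ?_, hyl, ?_, ?_⟩
  · exact superdifferential_of_hasGradientAt hχp hχd (hy k) ((hφd.hasGradientAt _).fun_add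
      (contDiff_periodicSq.hasGradientAt _).comp_sub_const)
  · have h1 := (hφd.continuous_gradient.tendsto x).comp hyl
    have h2 := (contDiff_periodicSq.continuous_gradient.tendsto (x - x)).comp
      (hyl.sub (tendsto_const_nhds (x := x)))
    rw [sub_self, gradient_periodicSq_zero] at h2
    simpa using h1.add h2
  · have hφl := (hφd.continuous.tendsto x).comp hyl
    have hul := (huc.tendsto x).comp hyl
    have hlow : Tendsto (fun k => v k x - φ x + φ (y k)) l (𝓝 (u x)) := by
      simpa using (hx.sub (tendsto_const_nhds (x := φ x))).add hφl
    rw [tendsto_order]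
    constructor
    · intro a ha
      filter_upwards [hlow.eventually (lt_mem_nhds ha)] with k hk
      have := hbound k
      have := sq_nonneg ‖y k - x‖
      linarith
    · intro a ha
      have hε : 0 < (a - u x) / 2 := by linarith
      filter_upwards [hle _ hε, hul.eventually (gt_mem_nhds (show u x < (a + u x) / 2 by linarith))]
        with k h1 h2
      have := h1 (y k)
      simp only [Function.comp] at h2
      linarith

/-- Superdifferentials are nonempty on a dense set. -/
lemma exists_tendsto_mem_superdifferential {u : Space N → ℝ} (hu : IsPeriodic u)
    (huc : Continuous u) (x : Space N) :
    ∃ (y q : ℕ → Space N), (∀ k, q k ∈ superdifferential u (y k)) ∧ Tendsto y atTop (𝓝 x) := by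
  obtain ⟨M, hM⟩ := hu.exists_forall_le huc
  have h : ∀ k : ℕ, ∃ y q, q ∈ superdifferential u y ∧
      8 * ‖y - x‖ ^ 2 ≤ (u M - u x) * (1 / ((k : ℝ) + 1)) := fun k => by
    have hk : (0 : ℝ) < (k : ℝ) + 1 := by positivity
    have hχp : IsPeriodic fun w => ((k : ℝ) + 1) * periodicSq (w - x) :=
      (isPeriodic_periodicSq.comp_sub x).const_mul _
    have hχd : ContDiff ℝ 1 fun w => ((k : ℝ) + 1) * periodicSq (w - x) :=
      contDiff_const.mul (contDiff_periodicSq_sub x)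
    obtain ⟨y, hy⟩ := (hu.sub hχp).exists_forall_le (huc.sub hχd.continuous)
    obtain ⟨z, hz⟩ := exists_eight_mul_norm_sq_le (y - x)
    refine ⟨y + latticePoint z, _, superdifferential_add_latticePoint hu
      (superdifferential_of_hasGradientAt hχp hχd hy (hχd.hasGradientAt y)) z, ?_⟩
    rw [add_sub_right_comm]
    refine hz.trans ?_
    have h1 := hy x
    simp only [sub_self, periodicSq_zero, mul_zero] at h1
    have h2 := hM y
    rw [mul_one_div, le_div_iff₀ hk]
    linarith
  choose y q hq hy using h
  refine ⟨y, q, hq, ?_⟩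
  have hl : Tendsto (fun k : ℕ => (u M - u x) * (1 / ((k : ℝ) + 1))) atTop (𝓝 0) := by
    simpa using (tendsto_const_nhds (x := u M - u x)).mul
      (tendsto_one_div_add_atTop_nhds_zero_nat (𝕜 := ℝ))
  rw [Metric.tendsto_nhds]
  intro ε hε
  have hε2 : 0 < 8 * ε ^ 2 := by positivity
  filter_upwards [hl.eventually (gt_mem_nhds hε2)] with k hk
  rw [dist_eq_norm]
  have := hy k
  refine lt_of_pow_lt_pow_left₀ 2 hε.le ?_
  linarith

/-! ### Perron's method for the discounted equation -/

/-- Gluing a `K`-Lipschitz function with bumps that are `K`-Lipschitz on balls outside of which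
they lie below it. -/
lemma lipschitzWith_max {u b : Space N → ℝ} {K : ℝ≥0} {ρ : ℝ} (hu : LipschitzWith K u)
    (hb : ∀ x, u x < b x → ∃ c, ‖x - c‖ < ρ ∧
      (∀ y y', ‖y - c‖ ≤ ρ → ‖y' - c‖ ≤ ρ → b y - b y' ≤ K * ‖y - y'‖) ∧
      ∀ y, ‖y - c‖ = ρ → b y ≤ u y) :
    LipschitzWith K fun x => max (u x) (b x) := by
  refine LipschitzWith.of_le_add_mul K fun x y => ?_
  have huxy : ∀ x y, u x ≤ u y + K * dist x y := fun x y => by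
    have := hu.dist_le_mul x y
    rw [Real.dist_eq] at this
    linarith [le_abs_self (u x - u y)]
  have hmu := le_max_left (u y) (b y)
  have hmb := le_max_right (u y) (b y)
  rcases le_or_gt (b x) (u x) with h | h
  · rw [max_eq_left h]
    exact (huxy x y).trans (by linarith)
  · rw [max_eq_right h.le]
    obtain ⟨c, hxc, hLip, hsph⟩ := hb x h
    rcases le_or_gt ‖y - c‖ ρ with hy | hy
    · have := hLip x y hxc.le hy
      rw [dist_eq_norm]
      linarith
    -- The segment from `x` to `y` meets the sphere at `x'`, where `b ≤ u`: use the bound for `b` up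
    -- to `x'` and that for `u` beyond. The two lengths add up exactly.
    · have hcont : ContinuousOn (fun s : ℝ => ‖x + s • (y - x) - c‖) (Set.Icc 0 1) := by fun_prop
      obtain ⟨s, hs, hsρ⟩ := intermediate_value_Icc zero_le_one hcont
        (show ρ ∈ Set.Icc _ _ by simpa using ⟨hxc.le, hy.le⟩)
      simp only at hsρ
      set x' := x + s • (y - x) with hx'
      have h1 := hLip x x' hxc.le hsρ.le
      have h2 := hsph x' hsρ
      have h3 := huxy x' y
      have e1 : ‖x - x'‖ = s * ‖y - x‖ := by
        rw [hx', sub_add_cancel_left, norm_neg, norm_smul, Real.norm_of_nonneg hs.1]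
      have e2 : dist x' y = (1 - s) * ‖y - x‖ := by
        have : x' - y = -((1 - s) • (y - x)) := by rw [hx']; module
        rw [dist_eq_norm, this, norm_neg, norm_smul, Real.norm_of_nonneg (by linarith [hs.2])]
      rw [dist_comm, dist_eq_norm]
      rw [e1] at h1
      rw [e2] at h3
      nlinarith

lemma sub_le_of_norm_gradient_le {b : Space N → ℝ} (hb : ContDiff ℝ 1 b) {c : Space N} {ρ K : ℝ}
    (hK : ∀ y, ‖y - c‖ ≤ ρ → ‖gradient b y‖ ≤ K) {y y' : Space N} (hy : ‖y - c‖ ≤ ρ)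
    (hy' : ‖y' - c‖ ≤ ρ) : b y - b y' ≤ K * ‖y - y'‖ := by
  have h := (convex_closedBall c ρ).norm_image_sub_le_of_norm_hasFDerivWithin_le
    (f := b) (f' := fun y => InnerProductSpace.toDual ℝ (Space N) (gradient b y)) (C := K)
    (x := y') (y := y)
    (fun x _ => (hb.hasGradientAt x).hasFDerivAt.hasFDerivWithinAt)
    (fun x hx => by
      rw [LinearIsometryEquiv.norm_map]
      exact hK x (by simpa [dist_eq_norm] using hx))
    (by simpa [dist_eq_norm] using hy') (by simpa [dist_eq_norm] using hy)
  exact (le_abs_self _).trans h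

/-- The `K`-Lipschitz subsolutions of the discounted equation `lam * u + F(x, Du) = 0`. -/
def discountedSubsolutions (F : Space N → Space N → ℝ) (lam : ℝ) (K : ℝ≥0) :
    Set (Space N → ℝ) :=
  {v | IsPeriodic v ∧ LipschitzWith K v ∧ ∀ x, ∀ p ∈ superdifferential v x, lam * v x + F x p ≤ 0}

/-- Perron's bump construction. -/
lemma exists_lt_mem_discountedSubsolutions {F : Space N → Space N → ℝ} (hFp : IsPeriodic F)
    (hF : Continuous fun q : Space N × Space N => F q.1 q.2) {lam : ℝ} (hlam : 0 < lam) {K : ℝ≥0}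
    {u : Space N → ℝ} (hu : u ∈ discountedSubsolutions F lam K) {x p : Space N}
    (hp : p ∈ subdifferential u x) (hpK : ‖p‖ < K) (hlt : lam * u x + F x p < 0) :
    ∃ w ∈ discountedSubsolutions F lam K, u x < w x := by
  obtain ⟨hup, huK, hus⟩ := hu
  obtain ⟨φ, hφ, hφd, hmin, hφx⟩ := hp
  set b₀ : Space N → ℝ := fun y => u x - φ x + (φ y + -periodicSq (y - x)) with hb₀
  have hb₀p : IsPeriodic b₀ :=
    (isPeriodic_const _).add (hφ.add (isPeriodic_periodicSq.comp_sub x).neg)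
  have hb₀d : ContDiff ℝ 1 b₀ :=
    contDiff_const.add (hφd.add (contDiff_periodicSq_sub x).neg)
  have hb₀x : b₀ x = u x := by simp [hb₀]
  have hg : gradient b₀ x = p := by
    have h0 : HasGradientAt (periodicSq (N := N)) 0 (x - x) := by
      rw [sub_self]
      simpa only [gradient_periodicSq_zero] using (contDiff_periodicSq (N := N)).hasGradientAt 0
    have h1 : HasGradientAt b₀ (0 + (gradient φ x + -0)) x :=
      (hasGradientAt_const x _).fun_add ((hφd.hasGradientAt x).fun_add h0.comp_sub_const.fun_neg)
    simpa [hφx] using h1.gradient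
  have hgc : Continuous (gradient b₀) := hb₀d.continuous_gradient
  have hev : ∀ᶠ y in 𝓝 x, ‖gradient b₀ y‖ < K ∧
      lam * b₀ y + F y (gradient b₀ y) < (lam * u x + F x p) / 2 := by
    refine (hgc.norm.continuousAt.eventually (gt_mem_nhds (by simpa only [hg] using hpK))).and ?_
    have hc : Continuous fun y => lam * b₀ y + F y (gradient b₀ y) :=
      (continuous_const.mul hb₀d.continuous).add (hF.comp (continuous_id.prodMk hgc))
    refine hc.continuousAt.eventually (gt_mem_nhds ?_)
    simp only [hb₀x, hg]
    linarith
  obtain ⟨ρ', hρ', hball⟩ := Metric.eventually_nhds_iff.1 hev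
  -- Radius at most `1/2` makes the quadratic bound for `periodicSq` valid on the sphere without a
  -- lattice shift.
  set ρ := min (ρ' / 2) (1 / 2)
  have hρ : 0 < ρ := by positivity
  have hρ2 : ρ ≤ 1 / 2 := min_le_right _ _
  have hloc : ∀ y, ‖y - x‖ ≤ ρ → ‖gradient b₀ y‖ < K ∧
      lam * b₀ y + F y (gradient b₀ y) < (lam * u x + F x p) / 2 := fun y hy => by
    refine hball ?_
    rw [dist_eq_norm]
    have : ρ ≤ ρ' / 2 := min_le_left _ _
    linarith
  -- The first bound keeps the raised bump below `u` on the sphere and off the lattice translates of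
  -- the ball; the second spends at most half of the strict gap in the equation.
  set δ := min (4 * ρ ^ 2) (-(lam * u x + F x p) / 2 / lam)
  have hδ : 0 < δ := lt_min (by positivity) (div_pos (by linarith) hlam)
  have hδρ : δ < 8 * ρ ^ 2 := (min_le_left _ _).trans_lt (by nlinarith)
  have hδlam : lam * δ ≤ -(lam * u x + F x p) / 2 := by
    rw [mul_comm, ← le_div_iff₀ hlam]
    exact min_le_right _ _
  set b : Space N → ℝ := fun y => b₀ y + δ with hb
  have hbp : IsPeriodic b := hb₀p.add (isPeriodic_const δ)
  have hbu : ∀ y, b y ≤ u y + δ - periodicSq (y - x) := fun y => by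
    simp only [hb, hb₀]
    linarith [hmin y]
  have hnear : ∀ y, u y < b y → ∃ z : Fin N → ℤ, ‖y + latticePoint z - x‖ < ρ := fun y hy => by
    obtain ⟨z, hz⟩ := exists_eight_mul_norm_sq_le (y - x)
    refine ⟨z, ?_⟩
    rw [add_sub_right_comm]
    refine lt_of_pow_lt_pow_left₀ 2 hρ.le ?_
    linarith [hbu y]
  have hper : ∀ y z, b y = b (y + latticePoint z) := fun y z => (hbp.add_latticePoint y z).symm
  have hwK : LipschitzWith K fun y => max (u y) (b y) := by
    refine lipschitzWith_max (ρ := ρ) huK fun y hy => ?_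
    obtain ⟨z, hz⟩ := hnear y hy
    have hsh : ∀ w, w - (x - latticePoint z) = w + latticePoint z - x := fun w => by abel
    refine ⟨x - latticePoint z, by rwa [hsh], fun w w' hw hw' => ?_, fun w hw => ?_⟩
    · rw [hsh] at hw hw'
      rw [hper w z, hper w' z]
      have h1 := sub_le_of_norm_gradient_le hb₀d (fun y hy => (hloc y hy).1.le) hw hw'
      rw [add_sub_add_right_eq_sub] at h1
      simp only [hb]
      linarith
    · rw [hsh] at hw
      have h1 : 8 * ‖w + latticePoint z - x‖ ^ 2 ≤ periodicSq (w + latticePoint z - x) :=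
        eight_mul_norm_sq_le fun i => (PiLp.norm_apply_le _ i).trans (hw.le.trans hρ2)
      rw [hw, add_sub_right_comm, isPeriodic_periodicSq.add_latticePoint] at h1
      linarith [hbu w]
  refine ⟨fun y => max (u y) (b y), ⟨fun y z => by simp only [hup y z, hbp y z], hwK, ?_⟩, ?_⟩
  · intro y q hq
    rcases le_or_gt (b y) (u y) with h | h
    · simp only [max_eq_left h]
      refine hus y q ?_
      obtain ⟨χ, hχ, hχd, hmax, hχq⟩ := hq
      refine ⟨χ, hχ, hχd, fun y' => ?_, hχq⟩
      have := hmax y'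
      simp only [max_eq_left h] at this
      linarith [le_max_left (u y') (b y')]
    · obtain ⟨z, hz⟩ := hnear y h
      have hq' := superdifferential_add_latticePoint
        (fun y z => by simp only [hup y z, hbp y z]) hq z
      have hFz : F y q = F (y + latticePoint z) q := by rw [hFp.add_latticePoint]
      simp only [max_eq_right h.le]
      rw [hper y z, hFz]
      rw [← hup.add_latticePoint y z, hper y z] at h
      set y' := y + latticePoint z
      obtain ⟨χ, hχ, hχd, hmax, hχq⟩ := hq'
      have hbg : HasGradientAt b (gradient b₀ y') y' := by
        simpa using (hb₀d.hasGradientAt y').fun_add (hasGradientAt_const y' δ)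
      have hqg := eq_gradient_of_mem_superdifferential hbg hχd (fun w => le_max_right (u w) (b w))
        (max_eq_right h.le).symm hmax
      rw [← hχq, hqg]
      have := (hloc y' hz.le).2
      simp only [hb]
      linarith
  · refine lt_max_of_lt_right ?_
    simp only [hb, hb₀x]
    linarith

/-- Perron: take the supremum of all `K`-Lipschitz subsolutions. It is a subsolution by stability.
Where the supersolution test fails, `F x p < C`, hence `‖p‖ < K`, and a bump stays in the class and
contradicts maximality. Fixing the Lipschitz constant in the class avoids semicontinuous envelopes.
-/
lemma exists_discounted_solution {F : Space N → Space N → ℝ} (hFp : IsPeriodic F)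
    (hF : Continuous fun q : Space N × Space N => F q.1 q.2) {C : ℝ} {K : ℝ≥0}
    (hC : ∀ x, |F x 0| ≤ C) (hK : ∀ x p, K ≤ ‖p‖ → C ≤ F x p) {lam : ℝ} (hlam : 0 < lam) :
    ∃ u : Space N → ℝ, LipschitzWith K u ∧ (∀ x, |lam * u x| ≤ C) ∧
      IsViscositySolution (fun x p => lam * u x + F x p) u := by
  set S := discountedSubsolutions F lam K with hS
  have hC' : lam * (C / lam) = C := by field_simp
  have hne : (fun _ => -(C / lam)) ∈ S := by
    refine ⟨isPeriodic_const _, (LipschitzWith.const _).weaken bot_le, fun x p hp => ?_⟩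
    rw [superdifferential_const hp, mul_neg, hC']
    linarith [(abs_le.1 (hC x)).2]
  have hle : ∀ v ∈ S, ∀ x, v x ≤ C / lam := fun v hv x => by
    obtain ⟨y, hy⟩ := hv.1.exists_forall_le hv.2.1.continuous
    have h1 := hv.2.2 y 0 (zero_mem_superdifferential hy)
    have h2 := (abs_le.1 (hC y)).1
    refine (hy x).trans ((le_div_iff₀ hlam).2 ?_)
    linarith [mul_comm (v y) lam]
  have hbdd : ∀ x, BddAbove ((fun v : Space N → ℝ => v x) '' S) := fun x =>
    ⟨C / lam, by rintro _ ⟨v, hv, rfl⟩; exact hle v hv x⟩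
  have hne' : ∀ x, ((fun v : Space N → ℝ => v x) '' S).Nonempty := fun x => ⟨_, _, hne, rfl⟩
  set u : Space N → ℝ := fun x => sSup ((fun v : Space N → ℝ => v x) '' S) with hu
  have hvu : ∀ v ∈ S, ∀ x, v x ≤ u x := fun v hv x => le_csSup (hbdd x) ⟨v, hv, rfl⟩
  have hup : IsPeriodic u := fun x z => by
    simp only [hu]
    congr 1
    exact Set.image_congr fun v hv => hv.1 x z
  have huK : LipschitzWith K u := by
    refine LipschitzWith.of_le_add_mul K fun x y => csSup_le (hne' x) ?_
    rintro _ ⟨v, hv, rfl⟩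
    have := hv.2.1.dist_le_mul x y
    rw [Real.dist_eq] at this
    linarith [le_abs_self (v x - v y), hvu v hv y]
  have hub : ∀ x, |lam * u x| ≤ C := fun x => by
    rw [abs_le]
    constructor
    · have h1 := mul_le_mul_of_nonneg_left (hvu _ hne x) hlam.le
      rwa [mul_neg, hC'] at h1
    · rw [← hC']
      refine mul_le_mul_of_nonneg_left (csSup_le (hne' x) ?_) hlam.le
      rintro _ ⟨v, hv, rfl⟩
      exact hle v hv x
  have hus : ∀ x, ∀ p ∈ superdifferential u x, lam * u x + F x p ≤ 0 := fun x p hp => by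
    have h : ∀ k : ℕ, ∃ v ∈ S, u x - 1 / ((k : ℝ) + 1) < v x := fun k => by
      obtain ⟨_, ⟨v, hv, rfl⟩, h⟩ := exists_lt_of_lt_csSup (hne' x)
        (show u x - 1 / ((k : ℝ) + 1) < u x from sub_lt_self _ (by positivity))
      exact ⟨v, hv, h⟩
    choose v hv hvx using h
    have hlim : Tendsto (fun k => v k x) atTop (𝓝 (u x)) := by
      refine tendsto_of_tendsto_of_tendsto_of_le_of_le ?_ tendsto_const_nhds
        (fun k => (hvx k).le) (fun k => hvu _ (hv k) x)
      simpa using (tendsto_const_nhds (x := u x)).sub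
        (tendsto_one_div_add_atTop_nhds_zero_nat (𝕜 := ℝ))
    obtain ⟨y, q, hq, hyl, hql, hvl⟩ := exists_tendsto_superdifferential huK.continuous
      (fun k => (hv k).1) (fun k => (hv k).2.1.continuous) hp
      (fun ε hε => Eventually.of_forall fun k y => (hvu _ (hv k) y).trans (by linarith)) hlim
    refine le_of_tendsto' ((hvl.const_mul lam).add
      ((hF.tendsto (x, p)).comp (hyl.prodMk_nhds hql))) fun k => (hv k).2.2 _ _ (hq k)
  refine ⟨u, huK, hub, ⟨hup, huK.continuous, hus⟩, hup, huK.continuous, fun x p hp => ?_⟩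
  by_contra hcon
  push Not at hcon
  have hpK : ‖p‖ < K := by
    by_contra h
    push Not at h
    linarith [hK x p h, (abs_le.1 (hub x)).1]
  obtain ⟨w, hw, hlt⟩ := exists_lt_mem_discountedSubsolutions hFp hF hlam ⟨hup, huK, hus⟩ hp hpK hcon
  exact absurd (hvu w hw x) (not_le.2 hlt)

/-! ### Vanishing discount and the cell problem -/

lemma _root_.Ultrafilter.exists_tendsto_of_abs_le {ι : Type} (U : Ultrafilter ι) {f : ι → ℝ} {M : ℝ}
    (hf : ∀ k, |f k| ≤ M) : ∃ a, Tendsto f U (𝓝 a) := by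
  obtain ⟨a, -, ha⟩ := (isCompact_Icc (a := -M) (b := M)).ultrafilter_le_nhds (U.map f) (by
    rw [le_principal_iff]
    exact Filter.mem_map.2 (univ_mem' fun k => abs_le.1 (hf k)))
  exact ⟨a, ha⟩

/-- Equi-Lipschitz functions that converge on a finite `r`-net of the cell are uniformly close
there, hence everywhere by periodicity. -/
lemma eventually_forall_abs_sub_le {ι : Type} {l : Filter ι} {v : ι → Space N → ℝ}
    {w : Space N → ℝ} {K : ℝ≥0} (hv : ∀ k, IsPeriodic (v k)) (hvK : ∀ k, LipschitzWith K (v k))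
    (hw : IsPeriodic w) (hwK : LipschitzWith K w) (hlim : ∀ x, Tendsto (fun k => v k x) l (𝓝 (w x)))
    {ε : ℝ} (hε : 0 < ε) : ∀ᶠ k in l, ∀ x, |v k x - w x| ≤ ε := by
  have hK : (0 : ℝ) ≤ K := K.2
  set r := ε / (3 * (K + 1)) with hr
  have hr0 : 0 < r := by positivity
  have hKr : K * r ≤ ε / 3 := by
    rw [hr, mul_div_assoc', div_le_div_iff₀ (by positivity) (by positivity)]
    nlinarith
  obtain ⟨t, -, ht, hcov⟩ := isCompact_cell.finite_cover_balls (X := Space N) (s := cell N) hr0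
  have hev : ∀ᶠ k in l, ∀ y ∈ t, |v k y - w y| < ε / 3 := by
    rw [ht.eventually_all]
    intro y _
    have := Metric.tendsto_nhds.1 (hlim y) (ε / 3) (by positivity)
    simpa [Real.dist_eq] using this
  filter_upwards [hev] with k hk x
  obtain ⟨z, hz⟩ := exists_mem_cell x
  rw [← (hv k).add_latticePoint x z, ← hw.add_latticePoint x z]
  set x' := x + latticePoint z
  obtain ⟨y, hy, hxy⟩ : ∃ y ∈ t, x' ∈ Metric.ball y r := by simpa using hcov hz
  have hxy' : dist x' y ≤ r := (Metric.mem_ball.1 hxy).le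
  have h1 := ((hvK k).dist_le_mul x' y).trans (mul_le_mul_of_nonneg_left hxy' hK)
  have h2 := (hwK.dist_le_mul x' y).trans (mul_le_mul_of_nonneg_left hxy' hK)
  have h3 := hk y hy
  rw [Real.dist_eq] at h1 h2
  rw [abs_le] at h1 h2 ⊢
  rw [abs_lt] at h3
  constructor <;> linarith

/-- Solvability of the cell problem for continuous coercive Hamiltonians. -/
lemma exists_isCellSolution {H : Space N → Space N → ℝ} (hHp : IsPeriodic H)
    (hH : Continuous fun q : Space N × Space N => H q.1 q.2) (hco : IsCoercive H) (P : Space N) :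
    ∃ u a, IsCellSolution H P u a := by
  set F : Space N → Space N → ℝ := fun x p => H x (p + P) with hFdef
  have hFp : IsPeriodic F := fun x z => by simp only [hFdef, hHp x z]
  have hF : Continuous fun q : Space N × Space N => F q.1 q.2 :=
    hH.comp (continuous_fst.prodMk (continuous_snd.add continuous_const))
  have hF0 : IsPeriodic fun x => |F x 0| := fun x z => by simp only [hFp x z]
  obtain ⟨x₀, hx₀⟩ := hF0.exists_forall_le
    (hF.comp (continuous_id.prodMk continuous_const)).abs
  set C := |F x₀ 0|
  obtain ⟨r, hr⟩ := hco C
  -- If `‖p‖ ≥ |r| + ‖P‖`, then `‖p + P‖ ≥ r`, where coercivity gives `F x p ≥ C`.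
  set K : ℝ≥0 := ⟨|r| + ‖P‖, by positivity⟩
  have hK : ∀ x p, (K : ℝ) ≤ ‖p‖ → C ≤ F x p := fun x p hp => by
    refine hr x (p + P) ?_
    have h1 : |r| + ‖P‖ ≤ ‖p‖ := hp
    have h2 := norm_sub_le (p + P) P
    rw [add_sub_cancel_right] at h2
    linarith [le_abs_self r]
  have hlam : ∀ k : ℕ, (0 : ℝ) < 1 / ((k : ℝ) + 1) := fun k => by positivity
  choose u huK hub hus using fun k : ℕ =>
    exists_discounted_solution (K := K) hFp hF hx₀ hK (hlam k)
  -- Along one ultrafilter every bounded sequence converges, so no diagonal extraction is needed.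
  set U : Ultrafilter ℕ := hyperfilter ℕ
  have hlam0 : Tendsto (fun k : ℕ => 1 / ((k : ℝ) + 1)) U (𝓝 0) :=
    tendsto_one_div_add_atTop_nhds_zero_nat.mono_left Nat.hyperfilter_le_atTop
  -- Only `lam * u` is bounded uniformly in `k`. Subtracting the value at `0` leaves locally bounded
  -- functions; the limit `c` of `lam * u k 0` yields the critical value `-c`.
  set v : ℕ → Space N → ℝ := fun k x => u k x - u k 0 with hv
  have hvp : ∀ k, IsPeriodic (v k) := fun k => (hus k).1.1.sub (isPeriodic_const _)
  have hvK : ∀ k, LipschitzWith K (v k) := fun k => by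
    refine LipschitzWith.of_dist_le_mul fun x y => ?_
    simpa [hv, Real.dist_eq] using (huK k).dist_le_mul x y
  have hvb : ∀ x k, |v k x| ≤ K * ‖x‖ := fun x k => by
    simpa [Real.dist_eq] using (huK k).dist_le_mul x 0
  obtain ⟨c, hc⟩ := U.exists_tendsto_of_abs_le (fun k => hub k 0)
  choose w hw using fun x => U.exists_tendsto_of_abs_le (hvb x)
  have hwp : IsPeriodic w := fun x z => by
    refine tendsto_nhds_unique (hw _) ?_
    simpa only [hvp _ x z] using hw x
  have hwK : LipschitzWith K w := by
    refine LipschitzWith.of_dist_le_mul fun x y => ?_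
    exact le_of_tendsto' ((hw x).dist (hw y)) fun k => (hvK k).dist_le_mul x y
  have hunif : ∀ ε > 0, ∀ᶠ k in (U : Filter ℕ), ∀ x, |v k x - w x| ≤ ε := fun ε hε =>
    eventually_forall_abs_sub_le hvp hvK hwp hwK hw hε
  have hsup : ∀ x, ∀ p ∈ superdifferential w x, H x (p + P) - -c ≤ 0 := fun x p hp => by
    obtain ⟨y, q, hq, hyl, hql, hvl⟩ := exists_tendsto_superdifferential (l := (U : Filter ℕ))
      hwK.continuous hvp (fun k => (hvK k).continuous) hp
      (fun ε hε => (hunif ε hε).mono fun k hk y => by linarith [(abs_le.1 (hk y)).2]) (hw x)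
    have hFl := (hF.tendsto (x, p)).comp (hyl.prodMk_nhds hql)
    have hl := ((hlam0.mul hvl).add hc).add hFl
    have : 0 * w x + c + F x p ≤ 0 := le_of_tendsto' hl fun k => by
      obtain ⟨φ, h1, h2, h3, h4⟩ := hq k
      have h5 := (hus k).1.2.2 (y k) (q k) ⟨φ, h1, h2, fun y' => by linarith [h3 y'], h4⟩
      simp only [hv, Function.comp]
      linarith
    simp only [hFdef] at this
    linarith
  have hsub : ∀ x, ∀ p ∈ subdifferential w x, 0 ≤ H x (p + P) - -c := fun x p hp => by
    rw [mem_subdifferential_iff] at hp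
    obtain ⟨y, q, hq, hyl, hql, hvl⟩ := exists_tendsto_superdifferential (l := (U : Filter ℕ))
      (u := fun y => -w y) (v := fun k y => -v k y) hwK.continuous.neg (fun k => (hvp k).neg)
      (fun k => (hvK k).continuous.neg) hp
      (fun ε hε => (hunif ε hε).mono fun k hk y => by linarith [(abs_le.1 (hk y)).1]) (hw x).neg
    have hql' : Tendsto (fun k => -q k) (U : Filter ℕ) (𝓝 p) := by simpa using hql.neg
    have hFl := (hF.tendsto (x, p)).comp (hyl.prodMk_nhds hql')
    have hl := ((hlam0.mul hvl.neg).add hc).add hFl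
    have : 0 ≤ 0 * - -w x + c + F x p := ge_of_tendsto' hl fun k => by
      have hq' := mem_superdifferential_iff.1 (hq k)
      simp only [neg_neg] at hq'
      obtain ⟨φ, h1, h2, h3, h4⟩ := hq'
      have h5 := (hus k).2.2.2 (y k) (-q k) ⟨φ, h1, h2, fun y' => by linarith [h3 y'], h4⟩
      simp only [hv, Function.comp]
      linarith
    simp only [hFdef] at this
    linarith
  exact ⟨w, -c, ⟨K, hwK⟩, ⟨hwp, hwK.continuous, hsup⟩, hwp, hwK.continuous, hsub⟩

lemma exists_isEffectiveHamiltonian {H : Space N → Space N → ℝ} (hHp : IsPeriodic H)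
    (hH : Continuous fun q : Space N × Space N => H q.1 q.2) (hco : IsCoercive H) :
    ∃ Hbar, IsEffectiveHamiltonian H Hbar := by
  choose u a h using exists_isCellSolution hHp hH hco
  refine ⟨a, fun P => ⟨⟨u P, h P⟩, ?_⟩⟩
  rintro b ⟨v, ⟨K, hvK⟩, hv⟩
  obtain ⟨⟨K', huK⟩, hu⟩ := h P
  have hc : Continuous fun q : Space N × Space N => H q.1 (q.2 + P) :=
    hH.comp (continuous_fst.prodMk (continuous_snd.add continuous_const))
  exact le_antisymm
    (le_of_isSubsolution_of_isSupersolution (F := fun x p => H x (p + P)) hc huK hvK hu.1 hv.2)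
    (le_of_isSubsolution_of_isSupersolution (F := fun x p => H x (p + P)) hc hvK huK hv.1 hu.2)

/-! ### From superdifferential to subdifferential bounds -/

lemma abs_sin_sub_self_le_sq {t : ℝ} (ht : |t| ≤ 1) : |Real.sin t - t| ≤ t ^ 2 := by
  have h := Real.sin_bound ht
  have h3 : |t ^ 3 / 6| ≤ t ^ 2 / 6 := by
    rw [abs_div, abs_pow, abs_of_pos (by norm_num : (0 : ℝ) < 6), ← sq_abs t]
    have : |t| ^ 3 ≤ |t| ^ 2 := pow_le_pow_of_le_one (abs_nonneg t) ht (by norm_num)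
    linarith
  have h4 : |t| ^ 5 ≤ t ^ 2 := by
    rw [← sq_abs t]
    exact pow_le_pow_of_le_one (abs_nonneg t) ht (by norm_num)
  have h5 : Real.sin t - t = (Real.sin t - (t - t ^ 3 / 6)) - t ^ 3 / 6 := by ring
  rw [h5]
  refine (abs_sub _ _).trans ?_
  have := sq_nonneg t
  linarith

/-- A periodic function which agrees to first order at `0` with the linear form given by `p`. -/
noncomputable def periodicLinear (p x : Space N) : ℝ :=
  ∑ i, p i * (Real.sin (2 * Real.pi * x i) / (2 * Real.pi))

lemma isPeriodic_periodicLinear (p : Space N) : IsPeriodic (periodicLinear p) := by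
  intro x z
  refine Finset.sum_congr rfl fun i _ => ?_
  have h : 2 * Real.pi * (x + WithLp.toLp 2 (fun i => (z i : ℝ)) : Space N) i
      = 2 * Real.pi * x i + z i * (2 * Real.pi) := by
    simp only [PiLp.add_apply]; ring
  rw [h, Real.sin_add_int_mul_two_pi]

lemma contDiff_periodicLinear (p : Space N) : ContDiff ℝ 1 (periodicLinear p) := by
  unfold periodicLinear
  refine ContDiff.sum fun i _ => contDiff_const.mul (ContDiff.div_const ?_ _)
  exact Real.contDiff_sin.comp (contDiff_const.mul (contDiff_coord i))

@[simp] lemma periodicLinear_zero (p : Space N) : periodicLinear p 0 = 0 := by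
  simp [periodicLinear]

lemma abs_periodicLinear_le (p x : Space N) : |periodicLinear p x| ≤ ∑ i, |p i| := by
  refine (Finset.abs_sum_le_sum_abs _ _).trans (Finset.sum_le_sum fun i _ => ?_)
  rw [abs_mul]
  refine mul_le_of_le_one_right (abs_nonneg _) ?_
  have hpi : (0 : ℝ) < 2 * Real.pi := by positivity
  rw [abs_div, abs_of_pos hpi, div_le_one hpi]
  linarith [Real.abs_sin_le_one (2 * Real.pi * x i), Real.pi_gt_three]

lemma abs_periodicLinear_sub_inner_le (p : Space N) {x : Space N} (hx : ‖x‖ ≤ 1 / 8) :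
    |periodicLinear p x - inner ℝ p x| ≤ 2 * Real.pi * ‖p‖ * ‖x‖ ^ 2 := by
  have hpi : (0 : ℝ) < 2 * Real.pi := by positivity
  have hin : inner ℝ p x = ∑ i, p i * x i := by
    rw [PiLp.inner_apply]
    exact Finset.sum_congr rfl fun i _ => by simp [mul_comm]
  rw [hin, periodicLinear, ← Finset.sum_sub_distrib, EuclideanSpace.real_norm_sq_eq, Finset.mul_sum]
  refine (Finset.abs_sum_le_sum_abs _ _).trans (Finset.sum_le_sum fun i _ => ?_)
  have hxi : |x i| ≤ 1 / 8 := (PiLp.norm_apply_le x i).trans hx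
  have hpi' : |p i| ≤ ‖p‖ := PiLp.norm_apply_le p i
  have ht : |2 * Real.pi * x i| ≤ 1 := by
    rw [abs_mul, abs_of_pos hpi]
    nlinarith [Real.pi_lt_four, abs_nonneg (x i)]
  have h := abs_sin_sub_self_le_sq ht
  have e : p i * (Real.sin (2 * Real.pi * x i) / (2 * Real.pi)) - p i * x i
      = p i * ((Real.sin (2 * Real.pi * x i) - 2 * Real.pi * x i) / (2 * Real.pi)) := by
    field_simp
  rw [e, abs_mul, abs_div, abs_of_pos hpi]
  have h2 : |Real.sin (2 * Real.pi * x i) - 2 * Real.pi * x i| / (2 * Real.pi)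
      ≤ 2 * Real.pi * x i ^ 2 := by
    rw [div_le_iff₀ hpi]
    exact h.trans_eq (by ring)
  calc _ ≤ ‖p‖ * (2 * Real.pi * x i ^ 2) :=
        mul_le_mul hpi' h2 (by positivity) (norm_nonneg _)
    _ = _ := by ring

lemma hasGradientAt_periodicLinear (p : Space N) : HasGradientAt (periodicLinear p) p 0 := by
  rw [hasGradientAt_iff_hasFDerivAt, hasFDerivAt_iff_isLittleO_nhds_zero]
  refine Asymptotics.IsBigO.trans_isLittleO (g := fun h : Space N => ‖h‖ ^ 2) ?_ ?_
  · refine Asymptotics.IsBigO.of_bound (2 * Real.pi * ‖p‖) ?_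
    filter_upwards [Metric.closedBall_mem_nhds (0 : Space N) (by norm_num : (0 : ℝ) < 1 / 8)]
      with h hh
    simpa using abs_periodicLinear_sub_inner_le p (by simpa using hh)
  · exact Asymptotics.isLittleO_norm_pow_id one_lt_two

/-- A local quadratic upper bound yields an element of the superdifferential. -/
lemma mem_superdifferential_of_local_bound {f : Space N → ℝ} (hf : IsPeriodic f)
    (hfc : Continuous f) {x p : Space N} {C ρ : ℝ} (hρ : 0 < ρ)
    (h : ∀ z, ‖z‖ ≤ ρ → f (x + z) ≤ f x + inner ℝ p z + C * ‖z‖ ^ 2) :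
    p ∈ superdifferential f x := by
  obtain ⟨xm, hxm⟩ := hf.exists_forall_le hfc
  set r := min ρ (1 / 8)
  have hr0 : 0 < r := by positivity
  set B := ∑ i, |p i|
  have hB : 0 ≤ B := Finset.sum_nonneg fun i _ => abs_nonneg _
  -- The first two terms absorb the quadratic errors of `f` and `periodicLinear` on the ball of
  -- radius `r`; the last one beats the oscillation of both functions outside it.
  set A := |C| + 2 * Real.pi * ‖p‖ + (f xm - f x + B) / r ^ 2 with hA
  have hD : 0 ≤ (f xm - f x + B) / r ^ 2 := div_nonneg (by linarith [hxm x]) (by positivity)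
  have hP : 0 ≤ 2 * Real.pi * ‖p‖ := by positivity
  have hA0 : 0 ≤ A := by positivity
  set φ : Space N → ℝ := fun y => periodicLinear p (y - x) + A * periodicSq (y - x) with hφ
  have hφp : IsPeriodic φ := ((isPeriodic_periodicLinear p).comp_sub x).add
    ((isPeriodic_periodicSq.comp_sub x).const_mul A)
  have hφd : ContDiff ℝ 1 φ :=
    ((contDiff_periodicLinear p).comp (contDiff_id.sub contDiff_const)).add
      (contDiff_const.mul (contDiff_periodicSq_sub x))
  refine superdifferential_of_hasGradientAt hφp hφd (fun y => ?_) ?_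
  · obtain ⟨z, hz⟩ := exists_eight_mul_norm_sq_le (y - x)
    rw [← hf.add_latticePoint y z, ← hφp.add_latticePoint y z]
    set w := y - x + latticePoint z with hw
    have hy : y + latticePoint z = x + w := by rw [hw]; abel
    rw [hy]
    rw [← isPeriodic_periodicSq.add_latticePoint (y - x) z] at hz
    have hAz := mul_le_mul_of_nonneg_left hz hA0
    have hφx : φ x = 0 := by simp [hφ]
    have hφw : φ (x + w) = periodicLinear p w + A * periodicSq w := by simp [hφ]
    rw [hφx, hφw]
    have hw2 := sq_nonneg ‖w‖
    rcases le_or_gt ‖w‖ r with hwr | hwr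
    · have h1 := h w (hwr.trans (min_le_left _ _))
      have h2 := (abs_le.1 (abs_periodicLinear_sub_inner_le p (hwr.trans (min_le_right _ _)))).1
      have h3 : (C + 2 * Real.pi * ‖p‖) * ‖w‖ ^ 2 ≤ A * (8 * ‖w‖ ^ 2) := by
        have : C + 2 * Real.pi * ‖p‖ ≤ A := by linarith [le_abs_self C]
        nlinarith [mul_nonneg hA0 hw2]
      linarith
    · have h1 := hxm (x + w)
      have h2 := (abs_le.1 (abs_periodicLinear_le p w)).1
      have h3 : f xm - f x + B ≤ A * (8 * ‖w‖ ^ 2) := by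
        have h4 : (f xm - f x + B) / r ^ 2 * r ^ 2 = f xm - f x + B := by field_simp
        have h5 : (f xm - f x + B) / r ^ 2 * r ^ 2 ≤ A * ‖w‖ ^ 2 :=
          mul_le_mul (by linarith [abs_nonneg C]) (by gcongr) (by positivity) hA0
        nlinarith [mul_nonneg hA0 hw2]
      linarith
  · have h0 : HasGradientAt (periodicSq (N := N)) 0 (x - x) := by
      rw [sub_self]
      simpa only [gradient_periodicSq_zero] using (contDiff_periodicSq (N := N)).hasGradientAt 0
    have h1 : HasGradientAt (periodicLinear p) p (x - x) := by
      rw [sub_self]; exact hasGradientAt_periodicLinear p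
    simpa using h1.comp_sub_const.fun_add (h0.comp_sub_const.const_mul_right A)

/-- Equivalent to `(‖v + z‖ - ‖v‖)² ≥ 0`. Away from its vertex, a cone is thus touched from above by
a paraboloid. -/
lemma norm_add_le_of_ne_zero {v : Space N} (hv : v ≠ 0) (z : Space N) :
    ‖v + z‖ ≤ ‖v‖ + inner ℝ v z / ‖v‖ + ‖z‖ ^ 2 / (2 * ‖v‖) := by
  have hs : 0 < ‖v‖ := norm_pos_iff.2 hv
  have h1 := norm_add_sq_real v z
  have h2 : ‖v‖ + inner ℝ v z / ‖v‖ + ‖z‖ ^ 2 / (2 * ‖v‖)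
      = (‖v + z‖ ^ 2 + ‖v‖ ^ 2) / (2 * ‖v‖) := by
    rw [h1]; field_simp; ring
  rw [h2, le_div_iff₀ (by positivity)]
  nlinarith [sq_nonneg (‖v + z‖ - ‖v‖)]

/-- A local bound on the superdifferentials of `u + ⟪P, ·⟫` bounds its subdifferentials. -/
lemma norm_add_le_of_mem_subdifferential {u : Space N → ℝ} (hu : IsPeriodic u) {K : ℝ≥0}
    (huK : LipschitzWith K u) {x P : Space N} {ρ c : ℝ} (hρ : 0 < ρ) (hc : 0 ≤ c)
    (h : ∀ y, ‖y - x‖ < ρ → ∀ p ∈ superdifferential u y, ‖p + P‖ ≤ c) {p : Space N}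
    (hp : p ∈ subdifferential u x) : ‖p + P‖ ≤ c := by
  by_contra! hcon
  obtain ⟨φ, hφ, hφd, hmin, rfl⟩ := hp
  set q := gradient φ x + P with hq
  have hK : (0 : ℝ) ≤ K := K.2
  -- Since `Aρ > K + ‖P‖`, the function `f` is negative on the sphere of radius `ρ`, so a positive
  -- maximum lies inside.
  set A := (K + ‖P‖ + 1) / ρ with hA
  have hA0 : 0 < A := by positivity
  have hAρ : A * ρ = K + ‖P‖ + 1 := by rw [hA]; field_simp
  set f : Space N → ℝ := fun y => u y + inner ℝ P (y - x) - u x - (c * ‖y - x‖ + A * ‖y - x‖ ^ 2)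
    with hf
  have hfc : Continuous f := by
    have := huK.continuous
    fun_prop
  obtain ⟨xm, hxm, hmax⟩ := (isCompact_closedBall x ρ).exists_isMaxOn
    ⟨x, by simpa using hρ.le⟩ hfc.continuousOn
  -- Otherwise the derivative at `x` along `q` would give `‖q‖² ≤ c‖q‖`. As `f x = 0`, the maximum
  -- avoids the vertex of the cone; there the cone plus paraboloid has a gradient of norm `c + 2A‖v‖
  -- > c`, which contradicts the hypothesis.
  have hpos : 0 < f xm := by
    by_contra! hle
    have hd1 := (hφd.hasGradientAt x).hasDerivAt_line q
    have hd2 : HasDerivAt (fun t : ℝ => t * (c * ‖q‖ - inner ℝ P q) + A * ‖q‖ ^ 2 * t ^ 2)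
        (c * ‖q‖ - inner ℝ P q) 0 := by
      have := ((hasDerivAt_id (0 : ℝ)).mul_const (c * ‖q‖ - inner ℝ P q)).fun_add
        ((hasDerivAt_pow 2 (0 : ℝ)).const_mul (A * ‖q‖ ^ 2))
      simpa using this
    have hq0 : 0 < ‖q‖ := hc.trans_lt hcon
    have h1 := nonneg_of_hasDerivAt_of_forall_le (hd2.fun_sub hd1) (ρ := ρ / ‖q‖) (by positivity)
      (fun t ht0 ht => by
        have hn : ‖x + t • q - x‖ = t * ‖q‖ := by
          rw [add_sub_cancel_left, norm_smul, Real.norm_of_nonneg ht0.le]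
        have h2 := (hmax (show x + t • q ∈ Metric.closedBall x ρ by
          rw [mem_closedBall_iff_norm, hn]
          exact ((lt_div_iff₀ hq0).1 ht).le)).trans hle
        simp only [hf, hn] at h2
        rw [add_sub_cancel_left, inner_smul_right] at h2
        have h3 := hmin (x + t • q)
        simp only [zero_smul, add_zero]
        nlinarith)
    have h2 : inner ℝ (gradient φ x) q + inner ℝ P q = ‖q‖ ^ 2 := by
      rw [← inner_add_left, ← hq, real_inner_self_eq_norm_sq]
    nlinarith
  have hne : xm - x ≠ 0 := by
    intro h0
    simp [hf, sub_eq_zero.1 h0] at hpos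
  have hs : 0 < ‖xm - x‖ := norm_pos_iff.2 hne
  set v := xm - x with hv
  have hlt : ‖v‖ < ρ := by
    refine lt_of_le_of_ne (by rwa [mem_closedBall_iff_norm] at hxm) fun heq => ?_
    have h1 := huK.dist_le_mul xm x
    rw [Real.dist_eq, dist_eq_norm, ← hv] at h1
    have h2 := real_inner_le_norm P v
    have h3 : A * ‖v‖ ^ 2 = (K + ‖P‖ + 1) * ‖v‖ := by rw [sq, ← mul_assoc, heq, hAρ]
    simp only [hf, ← hv] at hpos
    have := mul_nonneg hc hs.le
    nlinarith [le_abs_self (u xm - u x)]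
  set g := (c / ‖v‖ + 2 * A) • v with hg
  have hmem : g - P ∈ superdifferential u xm := by
    refine mem_superdifferential_of_local_bound hu huK.continuous (C := c / (2 * ‖v‖) + A)
      (sub_pos.2 hlt) fun z hz => ?_
    have e1 : xm + z - x = v + z := by rw [hv]; abel
    have h1 : f (xm + z) ≤ f xm := hmax (by
      rw [mem_closedBall_iff_norm, e1]
      linarith [norm_add_le v z])
    simp only [hf, e1, ← hv] at h1
    have h2 := mul_le_mul_of_nonneg_left (norm_add_le_of_ne_zero hne z) hc
    have h3 := norm_add_sq_real v z
    rw [inner_sub_left, hg, real_inner_smul_left]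
    rw [inner_add_right] at h1
    rw [h3] at h1
    have e2 : c * (‖v‖ + inner ℝ v z / ‖v‖ + ‖z‖ ^ 2 / (2 * ‖v‖))
        = c * ‖v‖ + c / ‖v‖ * inner ℝ v z + c / (2 * ‖v‖) * ‖z‖ ^ 2 := by ring
    linarith
  have hle := h xm hlt _ hmem
  rw [sub_add_cancel, hg, norm_smul, Real.norm_of_nonneg (by positivity)] at hle
  have e3 : (c / ‖v‖ + 2 * A) * ‖v‖ = c + 2 * A * ‖v‖ := by field_simp
  have : 0 < 2 * A * ‖v‖ := by positivity
  linarith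

/-! ### The infimal level as generalized effective Hamiltonian -/

/-- The constants `a` for which `H(x, Du + P) ≤ a` has a Lipschitz subsolution. -/
def subsolutionLevels (H : Space N → Space N → ℝ) (P : Space N) : Set ℝ :=
  {a | ∃ u : Space N → ℝ, (∃ K : ℝ≥0, LipschitzWith K u) ∧
    IsSubsolution (fun x p => H x (p + P) - a) u}

/-- The infimum of the constants `a` for which `H(x, Du + P) ≤ a` has a Lipschitz subsolution. -/
noncomputable def infLevel (H : Space N → Space N → ℝ) (P : Space N) : ℝ :=
  sInf (subsolutionLevels H P)

variable {H : Space N → Space N → ℝ}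

lemma mem_subsolutionLevels_of_forall_le {P : Space N} {a : ℝ} (h : ∀ x, H x P ≤ a) :
    a ∈ subsolutionLevels H P :=
  ⟨fun _ => 0, ⟨0, LipschitzWith.const 0⟩, isPeriodic_const 0, continuous_const, fun x p hp => by
    rw [superdifferential_const hp]
    simpa using h x⟩

/-- At a maximum point of the subsolution, `0` is a supergradient. -/
lemma exists_le_of_mem_subsolutionLevels {P : Space N} {a : ℝ} (ha : a ∈ subsolutionLevels H P) :
    ∃ x, H x P ≤ a := by
  obtain ⟨u, -, hup, huc, hu⟩ := ha
  obtain ⟨x, hx⟩ := hup.exists_forall_le huc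
  exact ⟨x, by simpa using hu x 0 (zero_mem_superdifferential hx)⟩

lemma bddBelow_subsolutionLevels {B : ℝ} (hB : ∀ x p, B ≤ H x p) (P : Space N) :
    BddBelow (subsolutionLevels H P) :=
  ⟨B, fun _ ha => by
    obtain ⟨x, hx⟩ := exists_le_of_mem_subsolutionLevels ha
    exact (hB x P).trans hx⟩

lemma subsolutionLevels_nonempty {M : ℝ} (hM : ∀ x p, H x p ≤ M) (P : Space N) :
    (subsolutionLevels H P).Nonempty :=
  ⟨M, mem_subsolutionLevels_of_forall_le fun x => hM x P⟩

lemma infLevel_le_add {B M Λ : ℝ} (hB : ∀ x p, B ≤ H x p) (hM : ∀ x p, H x p ≤ M)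
    (hΛ : ∀ x p q, |H x p - H x q| ≤ Λ * ‖p - q‖) (P Q : Space N) :
    infLevel H P ≤ infLevel H Q + Λ * ‖P - Q‖ := by
  rw [← sub_le_iff_le_add]
  refine le_csInf (subsolutionLevels_nonempty hM Q) fun a ⟨u, hK, hup, huc, hu⟩ => ?_
  rw [sub_le_iff_le_add]
  refine csInf_le (bddBelow_subsolutionLevels hB P) ⟨u, hK, hup, huc, fun x p hp => ?_⟩
  have h1 := hu x p hp
  have h2 := (abs_le.1 (hΛ x (p + P) (p + Q))).2
  rw [add_sub_add_left_eq_sub] at h2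
  linarith

lemma abs_infLevel_sub_le {B M Λ : ℝ} (hB : ∀ x p, B ≤ H x p) (hM : ∀ x p, H x p ≤ M)
    (hΛ : ∀ x p q, |H x p - H x q| ≤ Λ * ‖p - q‖) (P Q : Space N) :
    |infLevel H P - infLevel H Q| ≤ Λ * ‖P - Q‖ := by
  have h1 := infLevel_le_add hB hM hΛ P Q
  have h2 := infLevel_le_add hB hM hΛ Q P
  rw [norm_sub_rev] at h2
  rw [abs_le]
  constructor <;> linarith

/-- If `u` is a subsolution at `k • P`, then `u / k` is one at `P`, because `H` does not decrease
under `p ↦ k • p`. -/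
lemma infLevel_le_smul {B M : ℝ} (hB : ∀ x p, B ≤ H x p) (hM : ∀ x p, H x p ≤ M) {k : ℝ}
    (hk : 1 ≤ k) (hmono : ∀ x p, H x p ≤ H x (k • p)) (P : Space N) :
    infLevel H P ≤ infLevel H (k • P) := by
  have hk0 : 0 < k := one_pos.trans_le hk
  refine le_csInf (subsolutionLevels_nonempty hM _) fun a ⟨u, ⟨K, hK⟩, hup, huc, hu⟩ => ?_
  refine csInf_le (bddBelow_subsolutionLevels hB P) ⟨fun x => k⁻¹ * u x,
    ⟨‖k⁻¹‖₊ * K, (lipschitzWith_smul k⁻¹).comp hK⟩, hup.const_mul _, huc.const_mul _,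
    fun x p ⟨φ, hφ, hφd, hmax, hφx⟩ => ?_⟩
  have hmem : k • p ∈ superdifferential u x := by
    refine superdifferential_of_hasGradientAt (hφ.const_mul k) (contDiff_const.mul hφd)
      (fun y => ?_) (hφx ▸ (hφd.hasGradientAt x).const_mul_right k)
    have h1 := mul_le_mul_of_nonneg_left (hmax y) hk0.le
    rw [mul_sub, mul_sub, mul_inv_cancel_left₀ hk0.ne', mul_inv_cancel_left₀ hk0.ne'] at h1
    exact h1
  have h1 := hu x _ hmem
  have h2 := hmono x (p + P)
  rw [smul_add] at h2
  linarith

/-- The infimal level is a generalized effective Hamiltonian. -/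
lemma isGeneralizedEffectiveHamiltonian_infLevel {B M Λ : ℝ} (hB : ∀ x p, B ≤ H x p)
    (hM : ∀ x p, H x p ≤ M) (hΛ0 : 0 ≤ Λ) (hΛ : ∀ x p q, |H x p - H x q| ≤ Λ * ‖p - q‖) :
    IsGeneralizedEffectiveHamiltonian H (infLevel H) := by
  intro Hn hHn Hbar hbar
  refine ⟨fun R hR ε hε => ?_, fun ε hε => ?_⟩
  -- Four errors of size `ε / 4`: near-optimality of `a`, moving `u` from `P₀` to `P`, replacing `H`
  -- by `H_n`, and the variation of `infLevel`.
  · set r := ε / (4 * (Λ + 1)) with hr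
    have hr0 : 0 < r := by positivity
    have hΛr : Λ * r ≤ ε / 4 := by
      rw [hr, mul_div_assoc', div_le_div_iff₀ (by positivity) (by positivity)]
      nlinarith
    -- The Lipschitz constant of the chosen subsolution, hence the threshold for `n`, depends on
    -- `P₀`; a finite cover of the ball makes it uniform.
    have hloc : ∀ P₀ : Space N, ∀ᶠ n in atTop, ∀ P, ‖P‖ ≤ R → ‖P - P₀‖ < r →
        Hbar n P ≤ infLevel H P + ε := fun P₀ => by
      obtain ⟨a, ⟨u, ⟨K, huK⟩, hup, huc, hu⟩, ha⟩ := exists_lt_of_csInf_lt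
        (subsolutionLevels_nonempty hM P₀)
        (show infLevel H P₀ < infLevel H P₀ + ε / 4 by linarith)
      have hK : (0 : ℝ) ≤ K := K.2
      obtain ⟨n₀, hn₀⟩ := hHn.converges.liminf_nonneg (K + R) (by positivity) (ε / 4)
        (by positivity)
      filter_upwards [eventually_ge_atTop n₀] with n hn P hPR hPr
      have hlip : Λ * ‖P - P₀‖ ≤ ε / 4 := (mul_le_mul_of_nonneg_left hPr.le hΛ0).trans hΛr
      have hsub : IsSubsolution (fun x p => Hn n x (p + P) - (a + ε / 4 + ε / 4)) u :=
        ⟨hup, huc, fun x p hp => by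
          have h1 := hu x p hp
          have h2 := (abs_le.1 (hΛ x (p + P) (p + P₀))).2
          rw [add_sub_add_left_eq_sub] at h2
          have h3 := hn₀ n hn x (p + P) ((norm_add_le _ _).trans
            (add_le_add (norm_le_of_mem_superdifferential huK hp) hPR))
          linarith⟩
      obtain ⟨v, ⟨K', hvK⟩, hv⟩ := (hbar n P).1
      have hc : Continuous fun q : Space N × Space N => Hn n q.1 (q.2 + P) :=
        (hHn.continuous n).comp (continuous_fst.prodMk (continuous_snd.add continuous_const))
      have h1 := le_of_isSubsolution_of_isSupersolution (F := fun x p => Hn n x (p + P))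
        hc huK hvK hsub hv.2
      have h2 := infLevel_le_add hB hM hΛ P₀ P
      rw [norm_sub_rev] at h2
      linarith
    obtain ⟨t, -, ht, hcov⟩ :=
      (isCompact_closedBall (0 : Space N) R).finite_cover_balls hr0
    obtain ⟨n₀, hn₀⟩ := eventually_atTop.1 ((ht.eventually_all).2 fun P₀ _ => hloc P₀)
    refine ⟨n₀, fun n hn _ P hP => ?_⟩
    obtain ⟨P₀, hP₀, hPP₀⟩ : ∃ P₀ ∈ t, P ∈ Metric.ball P₀ r := by
      simpa using hcov (show P ∈ Metric.closedBall 0 R by simpa using hP)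
    have := hn₀ n hn P₀ hP₀ P hP (mem_ball_iff_norm.1 hPP₀)
    linarith
  · obtain ⟨n₀, hn₀⟩ := hHn.converges.limsup_nonpos ε hε
    refine ⟨n₀, fun n hn _ P => ?_⟩
    obtain ⟨u, huK, hu, -⟩ := (hbar n P).1
    rw [sub_le_iff_le_add']
    refine csInf_le (bddBelow_subsolutionLevels hB P) ⟨u, huK, hu.1, hu.2.1, fun x p hp => ?_⟩
    have h1 := hu.2.2 x p hp
    have h2 := hn₀ n hn x (p + P)
    linarith

/-- The approximation of a bounded Hamiltonian by adding `(|p| - n)⁺`. -/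
lemma isApproximation_add_max {B : ℝ} (hHp : IsPeriodic H)
    (hH : Continuous fun q : Space N × Space N => H q.1 q.2) (hB : ∀ x p, B ≤ H x p) :
    IsApproximation H (fun n x p => H x p + max (‖p‖ - n) 0) where
  periodic n := fun x z => by simp only [hHp x z]
  continuous n := hH.add (((continuous_snd.norm).sub continuous_const).max continuous_const)
  coercive n := fun A => ⟨A - B + n, fun x p hp => by
    linarith [hB x p, le_max_left (‖p‖ - n) 0]⟩
  converges :=
    { liminf_nonneg := fun R _ ε hε => by
        obtain ⟨n₀, hn₀⟩ := exists_nat_ge R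
        refine ⟨n₀, fun n hn x p hp => ?_⟩
        have h1 : (n₀ : ℝ) ≤ n := by exact_mod_cast hn
        rw [max_eq_right (by linarith)]
        linarith
      limsup_nonpos := fun ε hε => ⟨0, fun n _ x p => by
        linarith [le_max_right (‖p‖ - n) 0]⟩ }

lemma eq_of_convergesFromAbove {ι : Type} {f g : ι → Space N → ℝ} {fn : ℕ → ι → Space N → ℝ}
    (hf : ConvergesFromAbove f fn) (hg : ConvergesFromAbove g fn) : f = g := by
  have key : ∀ {f g : ι → Space N → ℝ}, ConvergesFromAbove f fn → ConvergesFromAbove g fn →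
      ∀ i p, f i p ≤ g i p := by
    intro f g hf hg i p
    refine le_of_forall_pos_le_add fun ε hε => ?_
    obtain ⟨n₁, h₁⟩ := hf.limsup_nonpos (ε / 2) (by positivity)
    obtain ⟨n₂, h₂⟩ := hg.liminf_nonneg (‖p‖ + 1) (by positivity) (ε / 2) (by positivity)
    have h3 := h₁ (max n₁ n₂) (le_max_left _ _) i p
    have h4 := h₂ (max n₁ n₂) (le_max_right _ _) i p (by linarith)
    linarith
  funext i p
  exact le_antisymm (key hf hg i p) (key hg hf i p)

/-- The defining property says nothing unless some approximating sequence has effective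
Hamiltonians; solvability of coercive cell problems supplies one. -/
lemma IsGeneralizedEffectiveHamiltonian.unique {B : ℝ} (hHp : IsPeriodic H)
    (hH : Continuous fun q : Space N × Space N => H q.1 q.2) (hB : ∀ x p, B ≤ H x p)
    {G G' : Space N → ℝ} (hG : IsGeneralizedEffectiveHamiltonian H G)
    (hG' : IsGeneralizedEffectiveHamiltonian H G') : G = G' := by
  have ha := isApproximation_add_max hHp hH hB
  choose Hbar hbar using fun n =>
    exists_isEffectiveHamiltonian (ha.periodic n) (ha.continuous n) (ha.coercive n)
  exact congrFun (eq_of_convergesFromAbove (hG _ ha _ hbar) (hG' _ ha _ hbar)) ()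

/-! ### Radial Hamiltonians: lower bound and reflection -/

section Radial

variable {σ : Space N → ℝ} {m : ℝ → ℝ} {L : ℝ≥0}

/-- Levels of subsolutions are bounded below by the Hamiltonian at zero momentum. -/
lemma mul_apply_zero_le_of_mem_subsolutionLevels (hσ : Continuous σ) (hσ0 : ∀ x, 0 < σ x)
    (hm : MonotoneOn m (Set.Ici 0)) {P : Space N} {a : ℝ}
    (ha : a ∈ subsolutionLevels (fun x p => σ x * m ‖p‖) P) (x : Space N) : σ x * m 0 ≤ a := by
  obtain ⟨u, -, hup, huc, hu⟩ := ha
  obtain ⟨y, q, hq, hy⟩ := exists_tendsto_mem_superdifferential hup huc x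
  refine le_of_tendsto' (((hσ.tendsto x).comp hy).mul_const (m 0)) fun k => ?_
  have h1 := hu _ _ (hq k)
  have h2 := mul_le_mul_of_nonneg_left (hm (Set.self_mem_Ici (a := (0 : ℝ)))
    (norm_nonneg (q k + P)) (norm_nonneg _)) (hσ0 (y k)).le
  simp only [Function.comp]
  linarith

/-- Nothing is known about `m` on negative arguments; truncation keeps them out. -/
lemma continuous_comp_max (hm : LipschitzOnWith L m (Set.Ici 0)) :
    Continuous fun s => m (max s 0) :=
  hm.continuousOn.comp_continuous (continuous_id.max continuous_const) fun s => le_max_right s 0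

/-- Lipschitz subsolutions for a Hamiltonian with convex and symmetric sublevel sets may be
reflected. -/
lemma neg_mem_subsolutionLevels (hσ : Continuous σ) (hσ0 : ∀ x, 0 < σ x)
    (hmL : LipschitzOnWith L m (Set.Ici 0)) (hm : StrictMonoOn m (Set.Ici 0)) {P : Space N} {a : ℝ}
    (ha : a ∈ subsolutionLevels (fun x p => σ x * m ‖p‖) P) :
    a ∈ subsolutionLevels (fun x p => σ x * m ‖p‖) (-P) := by
  have h0 := mul_apply_zero_le_of_mem_subsolutionLevels hσ hσ0 hm.monotoneOn ha
  obtain ⟨u, ⟨K, huK⟩, hup, huc, hu⟩ := ha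
  refine ⟨fun x => -u x, ⟨K, huK.neg⟩, hup.neg, huc.neg, fun x p hp => ?_⟩
  rw [mem_superdifferential_iff] at hp
  simp only [neg_neg] at hp
  by_contra! hcon
  have hnorm : ‖p + -P‖ = ‖-p + P‖ := by rw [← norm_neg]; congr 1; abel
  rw [hnorm] at hcon
  set q := ‖-p + P‖ with hq
  -- If `q = 0`, then `hcon` contradicts the lower bound `σ x * m 0 ≤ a`. Positivity leaves room for
  -- a radius `c` strictly between `0` and `q`.
  have hq0 : 0 < q := by
    refine lt_of_le_of_ne (norm_nonneg _) fun h => ?_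
    rw [← h] at hcon
    linarith [h0 x]
  have hc : Continuous fun s => σ x * m (max s 0) := continuous_const.mul (continuous_comp_max hmL)
  -- The strict inequality survives at a smaller radius `c`, and then at all `y` near `x`. Strict
  -- monotonicity of `m` therefore bounds the nearby superdifferentials by `c`, which the cone lemma
  -- carries over to `q ≤ c`.
  have hev : ∀ᶠ s in 𝓝[<] q, a < σ x * m (max s 0) := by
    refine (hc.tendsto q).eventually (lt_mem_nhds ?_) |>.filter_mono nhdsWithin_le_nhds
    rw [max_eq_left hq0.le]
    linarith
  obtain ⟨c, hca, hc0, hcq⟩ := (hev.and (Ioo_mem_nhdsLT hq0)).exists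
  rw [max_eq_left hc0.le] at hca
  obtain ⟨ρ, hρ, hball⟩ := Metric.eventually_nhds_iff.1
    (((show Continuous fun y => σ y * m c from hσ.mul continuous_const).tendsto x).eventually
      (lt_mem_nhds hca))
  refine absurd (norm_add_le_of_mem_subdifferential (P := P) hup huK hρ hc0.le
    (fun y hy p' hp' => ?_) hp) (not_le.2 hcq)
  by_contra! hlt
  have h1 : σ y * m ‖p' + P‖ - a ≤ 0 := hu y p' hp'
  have h2 := hball (show dist y x < ρ by rwa [dist_eq_norm])
  have h3 := mul_lt_mul_of_pos_left (hm hc0.le (norm_nonneg (p' + P)) hlt) (hσ0 y)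
  linarith

end Radial

end CellProblem

theorem proposition3p3 (N : ℕ) (σ : CellProblem.Space N → ℝ) (m : ℝ → ℝ) (L : ℝ≥0)
    (hσ_per : CellProblem.IsPeriodic σ) (hσ_cont : Continuous σ) (hσ_pos : ∀ x, 0 < σ x)
    (hm_maps : ∀ r, 0 ≤ r → 0 < m r ∧ m r < 1)
    (hm_lip : LipschitzOnWith L m (Set.Ici 0))
    (hm_mono : StrictMonoOn m (Set.Ici 0))
    (hm_lim : Filter.Tendsto m Filter.atTop (nhds 1)) :
    ∃ Hinf : CellProblem.Space N → ℝ,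
      -- `Hinf` is the unique generalized effective Hamiltonian of `H(x, p) = σ(x) m(|p|)`
      CellProblem.IsGeneralizedEffectiveHamiltonian (fun x p => σ x * m ‖p‖) Hinf ∧
      (∀ G : CellProblem.Space N → ℝ,
        CellProblem.IsGeneralizedEffectiveHamiltonian (fun x p => σ x * m ‖p‖) G → G = Hinf) ∧
      (∀ P Q, |Hinf P - Hinf Q| ≤ (⨆ x, σ x) * L * ‖P - Q‖) ∧
      (∀ (P : CellProblem.Space N) (k : ℝ), 1 ≤ k → Hinf P ≤ Hinf (k • P)) ∧
      (∀ P, Hinf P = Hinf (-P)) ∧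
      (∀ P, max ((⨅ x, σ x) * m ‖P‖) ((⨆ x, σ x) * m 0) ≤ Hinf P ∧
        Hinf P ≤ (⨆ x, σ x) * m ‖P‖ ∧
        (⨆ x, σ x) * m ‖P‖ < ⨆ x, σ x) := by
  open CellProblem in
  obtain ⟨xM, hxM⟩ := hσ_per.exists_forall_le hσ_cont
  obtain ⟨xm, hxm⟩ := hσ_per.exists_forall_ge hσ_cont
  have hsup : ⨆ x, σ x = σ xM :=
    le_antisymm (ciSup_le hxM) (le_ciSup ⟨σ xM, Set.forall_mem_range.2 hxM⟩ xM)
  have hinf : ⨅ x, σ x = σ xm :=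
    le_antisymm (ciInf_le ⟨σ xm, Set.forall_mem_range.2 hxm⟩ xm) (le_ciInf hxm)
  rw [hsup, hinf]
  set H : Space N → Space N → ℝ := fun x p => σ x * m ‖p‖ with hH
  have hm0 : ∀ p : Space N, 0 < m ‖p‖ := fun p => (hm_maps _ (norm_nonneg p)).1
  have hm1 : ∀ p : Space N, m ‖p‖ < 1 := fun p => (hm_maps _ (norm_nonneg p)).2
  have hHp : IsPeriodic H := fun x z => by simp only [hH, hσ_per x z]
  have hHc : Continuous fun q : Space N × Space N => H q.1 q.2 := by
    have h1 := (continuous_comp_max hm_lip).comp (continuous_norm (E := Space N))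
    have h2 : Continuous fun p : Space N => m ‖p‖ := by
      refine h1.congr fun p => ?_
      simp only [Function.comp, max_eq_left (norm_nonneg p)]
    exact (hσ_cont.comp continuous_fst).mul (h2.comp continuous_snd)
  have hB : ∀ x p, 0 ≤ H x p := fun x p => (mul_pos (hσ_pos x) (hm0 p)).le
  have hM : ∀ x p, H x p ≤ σ xM := fun x p =>
    (mul_le_of_le_one_right (hσ_pos x).le (hm1 p).le).trans (hxM x)
  have hΛ : ∀ x p q, |H x p - H x q| ≤ σ xM * L * ‖p - q‖ := fun x p q => by
    have h1 := hm_lip.dist_le_mul ‖p‖ (norm_nonneg p) ‖q‖ (norm_nonneg q)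
    rw [Real.dist_eq, Real.dist_eq] at h1
    have h2 := h1.trans (mul_le_mul_of_nonneg_left (abs_norm_sub_norm_le p q) L.2)
    simp only [hH]
    rw [← mul_sub, abs_mul, abs_of_pos (hσ_pos x), mul_assoc]
    exact mul_le_mul (hxM x) h2 (abs_nonneg _) (hσ_pos xM).le
  have hΛ0 : 0 ≤ σ xM * L := mul_nonneg (hσ_pos xM).le L.2
  -- One inequality for every `P` suffices: applied to `-P` it gives the reverse one.
  have hneg : ∀ P, infLevel H (-P) ≤ infLevel H P := fun P =>
    csInf_le_csInf (bddBelow_subsolutionLevels hB _) (subsolutionLevels_nonempty hM _)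
      fun a ha => neg_mem_subsolutionLevels hσ_cont hσ_pos hm_lip hm_mono ha
  have hgen := isGeneralizedEffectiveHamiltonian_infLevel hB hM hΛ0 hΛ
  refine ⟨infLevel H, hgen, fun G hG => hG.unique hHp hHc hB hgen, abs_infLevel_sub_le hB hM hΛ,
    fun P k hk => infLevel_le_smul hB hM hk (fun x p => ?_) P, fun P => ?_, fun P => ⟨?_, ?_, ?_⟩⟩
  · refine mul_le_mul_of_nonneg_left (hm_mono.monotoneOn (norm_nonneg _) (norm_nonneg _) ?_)
      (hσ_pos x).le
    rw [norm_smul, Real.norm_of_nonneg (zero_le_one.trans hk)]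
    exact le_mul_of_one_le_left (norm_nonneg p) hk
  · exact le_antisymm (by simpa using hneg (-P)) (hneg P)
  · refine le_csInf (subsolutionLevels_nonempty hM P) fun a ha => max_le ?_ ?_
    · obtain ⟨x, hx⟩ := exists_le_of_mem_subsolutionLevels ha
      exact (mul_le_mul_of_nonneg_right (hxm x) (hm0 P).le).trans hx
    · exact mul_apply_zero_le_of_mem_subsolutionLevels hσ_cont hσ_pos hm_mono.monotoneOn ha xM
  · exact csInf_le (bddBelow_subsolutionLevels hB P) (mem_subsolutionLevels_of_forall_le fun x =>
      mul_le_mul_of_nonneg_right (hxM x) (hm0 P).le)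
  · exact mul_lt_of_lt_one_right (hσ_pos xM) (hm1 P)
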